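/- Let $\lambda>-\tfrac12$, $w_\lambda(t)=(1-t^2)^{\lambda-1/2}$ on $[-1,1]$, and let $C_n^\lambda$ be the Gegenbauer polynomials (for $\lambda=0$, by convention, the Chebyshev polynomials $T_n$). With $c_\lambda=1/\int_{-1}^1w_\lambda$ and $h_n^\lambda=c_\lambda\int_{-1}^1 |C_n^\lambda|^2w_\lambda$, put $\widehat f_n^{\,\lambda}=(h_n^\lambda)^{-1/2}c_\lambda\int_{-1}^1 f\,C_n^\lambda\, w_\lambda$ for $f\in L^2(w_\lambda)$, $n=0,1,2,\dots$. Let $D_\lambda=(1-t^2)\frac{d^2}{dt^2}-(2\lambda+1)t\frac{d}{dt}$, so that $-D_\lambda C_n^\lambda=n(n+2\lambda)C_n^\lambda$. For $s>0$, $g=(-D_\lambda)^sf$ means that $f,g\in L^2(w_\lambda)$ and $\widehat g_n^{\,\lambda}=(n(n+2\lambda))^s\,\widehat f_n^{\,\lambda}$ for all $n\ge 0$. Fix $s\ge\frac12$. For an integer $n_0\ge0$ let $X_{n_0}$ be the set of all (real-valued, or all complex-valued) $f\in L^2(w_\lambda)$ such that $(-D_\lambda)^{s}f\in L^2(w_\lambda)$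 and $\widehat f_j^{\,\lambda}=0$ for $0\le j\le n_0$. For $C\in\mathbb R$ consider the inequality $$\int_{-1}^1|f(t)|^2w_\lambda(t)\,dt\le C\int_{-1}^1(1-t)\,\bigl|(-D_\lambda)^{1/2}f(t)\bigr|^2w_\lambda(t)\,dt .\qquad(*)$$ For $n\ge1$ let $$\alpha_n=\sqrt{\frac{2\,\Gamma(\frac n2+1)\,\Gamma(\frac n2+\lambda+\frac12)}{(n+\lambda)\,\Gamma(\frac n2+\frac12)\,\Gamma(\frac n2+\lambda)}},\qquad \beta_\lambda(n)=\Bigl(1-\alpha_n^2+\frac{\alpha_n^2}{8n^2}\Bigr)n(n+2\lambda),\qquad \beta_\lambda(\infty)=\frac{(2\lambda-1)^2}{8},$$ and let $n(\lambda)$ be the smallest integer $N\ge0$ such that $\inf\{\beta_\lambda(n): n\ge1,\ n\ge N\}=\beta_\lambda(\infty)$, if such an $N$ exists. Then: 1. If $\lambda\ne\frac12$ and, for some $n_0\ge0$ and $C\in\mathbb R$, $(*)$ holds for all $f\in X_{n_0}$, then $C\ge C_\lambda:=\dfrac{8}{(2\lambda-1)^2}$. 2. If $\lambda=\frac12$,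 then for no $n_0\ge0$ and no finite $C$ does $(*)$ hold for all $f\in X_{n_0}$. 3. If $\lambda\ge0$, then $n(\lambda)$ exists. Whenever $\lambda\neq\frac12$ and $n(\lambda)$ exists, $(*)$ holds with $C=C_\lambda$ for all $f\in X_{n(\lambda)}$; thus equality $C=C_\lambda$ is attained for $n_0=n(\lambda)$. -/

import Mathlib

open MeasureTheory Polynomial

noncomputable section

namespace Gegenbauer

/-- The standard recursion for the Gegenbauer polynomials:
`C₀ = 1`, `C₁ = 2λt`, `(n+2) C_{n+2} = 2(n+1+λ) t C_{n+1} - (n+2λ) C_n`. -/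
def recPoly (lam : ℝ) : ℕ → ℝ[X]
  | 0 => 1
  | 1 => C (2 * lam) * X
  | n + 2 => C (1 / ((n : ℝ) + 2)) *
      (C (2 * ((n : ℝ) + 1 + lam)) * X * recPoly lam (n + 1)
        - C ((n : ℝ) + 2 * lam) * recPoly lam n)

open Classical in
/-- The Gegenbauer polynomial `C_n^λ`. For `λ = 0`, where the recursion above degenerates, it is
by convention the Chebyshev polynomial of the first kind `T_n`. -/
def poly (lam : ℝ) (n : ℕ) : ℝ[X] :=
  if lam = 0 then Polynomial.Chebyshev.T ℝ (n : ℤ) else recPoly lam n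

/-- The differential operator `D_λ = (1 - t²) d²/dt² - (2λ+1) t d/dt` (on polynomials). -/
def diffOp (lam : ℝ) (p : ℝ[X]) : ℝ[X] :=
  (1 - X ^ 2) * derivative (derivative p) - C (2 * lam + 1) * X * derivative p

theorem recPoly_succ_succ (lam : ℝ) (n : ℕ) :
    ((n : ℝ[X]) + 2) * recPoly lam (n + 2) =
      2 * ((n : ℝ[X]) + 1 + C lam) * X * recPoly lam (n + 1)
        - ((n : ℝ[X]) + 2 * C lam) * recPoly lam n := by
  have h : ((n : ℝ[X]) + 2) * C (1 / ((n : ℝ) + 2)) = 1 := by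
    have h2 : ((n : ℝ[X]) + 2) = C ((n : ℝ) + 2) := by
      simp only [C_add, map_natCast, map_ofNat]
    rw [h2, ← C_mul, mul_one_div_cancel (by positivity), C_1]
  rw [recPoly, ← mul_assoc, h, one_mul]
  simp only [C_mul, C_add, C_1, map_natCast, map_ofNat]

theorem recPoly_derivative (lam : ℝ) (n : ℕ) :
    X * derivative (recPoly lam (n + 1)) - derivative (recPoly lam n)
        = ((n : ℝ[X]) + 1) * recPoly lam (n + 1) ∧
      derivative (recPoly lam (n + 1)) - X * derivative (recPoly lam n)
        = ((n : ℝ[X]) + 2 * C lam) * recPoly lam n := by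
  induction n with
  | zero =>
    constructor
    · simp [recPoly, mul_comm]
    · simp [recPoly, map_ofNat (C : ℝ →+* ℝ[X]) 2]
  | succ n ih =>
    obtain ⟨hA, hB⟩ := ih
    have hr := recPoly_succ_succ lam n
    have hd := congrArg derivative hr
    simp only [derivative_mul, derivative_sub, derivative_add, derivative_natCast,
      derivative_C, derivative_X, derivative_ofNat, derivative_one] at hd
    have hne : ((n : ℝ[X]) + 2) ≠ 0 := by
      have h2 : ((n : ℝ[X]) + 2) = C ((n : ℝ) + 2) := by
        simp only [C_add, map_natCast, map_ofNat]
      rw [h2, Ne, C_eq_zero]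
      positivity
    have hB' : derivative (recPoly lam (n + 2)) - X * derivative (recPoly lam (n + 1))
        = ((n : ℝ[X]) + 1 + 2 * C lam) * recPoly lam (n + 1) := by
      apply mul_left_cancel₀ hne
      linear_combination hd + ((n : ℝ[X]) + 2 * C lam) * hA
    refine ⟨?_, by push_cast; exact hB'⟩
    push_cast
    linear_combination X * hB' - hr + X * hA - hB

/-- The Gegenbauer polynomials are eigenfunctions: `D_λ C_n^λ = -n(n+2λ) C_n^λ`. This is what
justifies the spectral definition of the powers of `-D_λ` in `IsFracPow` below. -/
theorem diffOp_poly (lam : ℝ) (n : ℕ) :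
    diffOp lam (poly lam n) = C (-((n : ℝ) * (n + 2 * lam))) * poly lam n := by
  unfold poly diffOp
  split_ifs with h0
  · subst h0
    have h := Polynomial.Chebyshev.one_sub_X_sq_mul_derivative_derivative_T_eq_poly_in_T
      (R := ℝ) (n : ℤ)
    simp only [Function.iterate_succ, Function.iterate_zero, Function.comp, id] at h
    rw [h]
    simp only [mul_zero, zero_add, add_zero, C_1, C_neg, C_mul, map_natCast, Int.cast_natCast]
    ring
  · cases n with
    | zero => simp [recPoly]
    | succ n =>
      obtain ⟨hA, hB⟩ := recPoly_derivative lam n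
      have dA := congrArg derivative hA
      have dB := congrArg derivative hB
      simp only [derivative_mul, derivative_sub, derivative_add, derivative_natCast,
        derivative_C, derivative_X, derivative_ofNat, derivative_one] at dA dB
      simp only [C_neg, C_mul, C_add, C_1, map_natCast, map_ofNat, Nat.cast_add, Nat.cast_one]
      linear_combination dB - X * dA - ((n : ℝ[X]) + 2 * C lam + 1) * hA

/-- The weight `w_λ(t) = (1 - t²)^(λ - 1/2)`. -/
def weight (lam t : ℝ) : ℝ := (1 - t ^ 2) ^ (lam - 1 / 2)

/-- The measure `w_λ(t) dt` on `[-1, 1]`. -/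
def measure (lam : ℝ) : Measure ℝ :=
  (volume.restrict (Set.Icc (-1) 1)).withDensity fun t => ENNReal.ofReal (weight lam t)

/-- The normalization constant `c_λ = 1 / ∫ w_λ`. -/
def normConst (lam : ℝ) : ℝ := 1 / ∫ _t, (1 : ℝ) ∂(measure lam)

/-- `h_n^λ = c_λ ∫ (C_n^λ)² w_λ`. -/
def normSq (lam : ℝ) (n : ℕ) : ℝ :=
  normConst lam * ∫ t, ((poly lam n).eval t) ^ 2 ∂(measure lam)

/-- The Gegenbauer coefficient `(h_n^λ)^(-1/2) c_λ ∫ f C_n^λ w_λ`. -/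
def coeff {𝕜 : Type*} [RCLike 𝕜] (lam : ℝ) (f : ℝ → 𝕜) (n : ℕ) : 𝕜 :=
  (normConst lam / √(normSq lam n)) • ∫ t, ((poly lam n).eval t) • f t ∂(measure lam)

/-- `g = (-D_λ)^s f` in `L²(w_λ, [-1,1])`: both functions lie in this space and the `n`-th
coefficient of `g` is `(n(n+2λ))^s` times that of `f`. -/
structure IsFracPow {𝕜 : Type*} [RCLike 𝕜] (lam s : ℝ) (f g : ℝ → 𝕜) : Prop where
  memLp_left : MemLp f 2 (measure lam)
  memLp_right : MemLp g 2 (measure lam)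
  coeff_eq : ∀ n : ℕ, coeff lam g n = (((n : ℝ) * (n + 2 * lam)) ^ s) • coeff lam f n

/-- The Hardy–Rellich inequality with constant `c`, on the functions `f ∈ L²(w_λ, [-1,1])` with
`(-D_λ)^s f ∈ L²(w_λ, [-1,1])` whose coefficients of index `0, …, n₀` vanish. -/
def HardyRellich (𝕜 : Type*) [RCLike 𝕜] (lam s : ℝ) (n₀ : ℕ) (c : ℝ) : Prop :=
  ∀ f g : ℝ → 𝕜, IsFracPow lam (1 / 2) f g → (∃ h : ℝ → 𝕜, IsFracPow lam s f h) →
    (∀ j ≤ n₀, coeff lam f j = 0) →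
    ∫ t, ‖f t‖ ^ 2 ∂(measure lam) ≤ c * ∫ t, (1 - t) * ‖g t‖ ^ 2 ∂(measure lam)

/-- `α_n^λ`, for `n ≥ 1`. -/
def alpha (lam : ℝ) (n : ℕ) : ℝ :=
  √(2 * Real.Gamma (n / 2 + 1) * Real.Gamma (n / 2 + lam + 1 / 2) /
    ((n + lam) * Real.Gamma (n / 2 + 1 / 2) * Real.Gamma (n / 2 + lam)))

/-- `β_λ(n)`, for `n ≥ 1`. -/
def beta (lam : ℝ) (n : ℕ) : ℝ :=
  (1 - alpha lam n ^ 2 + alpha lam n ^ 2 / (8 * (n : ℝ) ^ 2)) * (n * (n + 2 * lam))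

/-- `β_λ(∞)`. -/
def betaInf (lam : ℝ) : ℝ := (2 * lam - 1) ^ 2 / 8

/-- `N = n(λ)`: the least `N` such that the infimum of `β_λ(n)` over the positive integers
`n ≥ N` equals `β_λ(∞)`. -/
def IsThreshold (lam : ℝ) (N : ℕ) : Prop :=
  IsLeast {N : ℕ | IsGLB (beta lam '' {n : ℕ | 1 ≤ n ∧ N ≤ n}) (betaInf lam)} N

end Gegenbauer

end

noncomputable section

namespace Gegenbauer

open Filter Topology

/-! Put `g = (-D_λ)^{1/2} f` and expand in orthonormal Gegenbauer polynomials. Multiplication by `t`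
is then a Jacobi matrix with zero diagonal, and `g_0 = 0` because the eigenvalue at 0 vanishes. So
the right-hand integral is `Σ |g_n|² - Σ √(jacobiSq n) Re(conj g_n · g_{n+1})` (`hasSum_jacobi`).
The Gamma quotient `α_n` is built so that `α_n α_{n+1} = √(jacobiSq n)` (`alpha_mul_succ`). With
`d_n = α_n |g_n|` the cross terms are at most `Σ d_n d_{n+1}`, which the discrete Hardy inequality
(`tsum_mul_succ_le_hardy`) bounds by `Σ (1 - 1/(8n²)) d_n²`. Since `|g_n|² = n(n+2λ)|f_n|²`, what is
left is `Σ β_λ(n)|f_n|²` (`tsum_beta_le`). If `f` has no coefficients up to the threshold, only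
indices with `β_λ(n) ≥ β_λ(∞)` matter, and the constant is `1/β_λ(∞) = C_λ`.

Conversely, `β_λ(n) → β_λ(∞)` (`tendsto_beta`), and Hardy's constant is optimal even on finitely
supported sequences vanishing up to any given index (`exists_hardy_near_extremal`). Dividing such
sequences by `α_n` gives polynomials in every `X_{n₀}` whose quotient of the two sides is at most
`β_λ(∞) + ε`. Hence `C β_λ(∞) ≥ 1`, which is the lower bound for `C`, and is absurd for `λ = 1/2`,
where `β_λ(∞) = 0`.

The threshold exists because `n(β_λ(n) - β_λ(∞)) → λ/4`, with `β_0` constant in the case `λ = 0`.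
The expansion of `α_n²` needed here is extracted from the product relation alone, once log-convexity
of Gamma has given the limit 1. -/

/-! ### The Gamma quotient `α_n`: product relation and limit. -/

/-- Log-convexity of Gamma at the midpoint of `z` and `z + 1`. -/
theorem Gamma_add_half_sq_le {z : ℝ} (hz : 0 < z) :
    Real.Gamma (z + 1 / 2) ^ 2 ≤ z * Real.Gamma z ^ 2 := by
  have h := Real.Gamma_mul_add_mul_le_rpow_Gamma_mul_rpow_Gamma (s := z) (t := z + 1)
    (a := 1 / 2) (b := 1 / 2) hz (by linarith) (by norm_num) (by norm_num) (by norm_num)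
  rw [show 1 / 2 * z + 1 / 2 * (z + 1) = z + 1 / 2 by ring, ← Real.sqrt_eq_rpow,
    ← Real.sqrt_eq_rpow, Real.Gamma_add_one hz.ne',
    ← Real.sqrt_mul (Real.Gamma_pos_of_pos hz).le] at h
  have h0 := (Real.Gamma_pos_of_pos (show 0 < z + 1 / 2 by linarith)).le
  calc Real.Gamma (z + 1 / 2) ^ 2 ≤ √(Real.Gamma z * (z * Real.Gamma z)) ^ 2 :=
        pow_le_pow_left₀ h0 h 2
    _ = Real.Gamma z * (z * Real.Gamma z) :=
        Real.sq_sqrt (mul_nonneg (Real.Gamma_pos_of_pos hz).le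
          (mul_nonneg hz.le (Real.Gamma_pos_of_pos hz).le))
    _ = z * Real.Gamma z ^ 2 := by ring

/-- The square of four times the off-diagonal Jacobi coefficient. -/
def jacobiSq (lam : ℝ) (n : ℕ) : ℝ :=
  ((n : ℝ) + 1) * (n + 2 * lam) / ((n + lam) * (n + 1 + lam))

variable {lam : ℝ}

theorem alpha_sq (hlam : -1 / 2 < lam) {n : ℕ} (hn : 1 ≤ n) :
    alpha lam n ^ 2 = 2 * Real.Gamma (n / 2 + 1) * Real.Gamma (n / 2 + lam + 1 / 2) /
      ((n + lam) * Real.Gamma (n / 2 + 1 / 2) * Real.Gamma (n / 2 + lam)) := by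
  have hn' : (1 : ℝ) ≤ n := by exact_mod_cast hn
  have h1 := Real.Gamma_pos_of_pos (show 0 < (n : ℝ) / 2 + 1 by linarith)
  have h2 := Real.Gamma_pos_of_pos (show 0 < (n : ℝ) / 2 + lam + 1 / 2 by linarith)
  have h3 := Real.Gamma_pos_of_pos (show 0 < (n : ℝ) / 2 + 1 / 2 by linarith)
  have h4 := Real.Gamma_pos_of_pos (show 0 < (n : ℝ) / 2 + lam by linarith)
  have h5 : 0 < (n : ℝ) + lam := by linarith
  exact Real.sq_sqrt (by positivity)

theorem alpha_pos (hlam : -1 / 2 < lam) {n : ℕ} (hn : 1 ≤ n) : 0 < alpha lam n := by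
  have hn' : (1 : ℝ) ≤ n := by exact_mod_cast hn
  have h1 := Real.Gamma_pos_of_pos (show 0 < (n : ℝ) / 2 + 1 by linarith)
  have h2 := Real.Gamma_pos_of_pos (show 0 < (n : ℝ) / 2 + lam + 1 / 2 by linarith)
  have h3 := Real.Gamma_pos_of_pos (show 0 < (n : ℝ) / 2 + 1 / 2 by linarith)
  have h4 := Real.Gamma_pos_of_pos (show 0 < (n : ℝ) / 2 + lam by linarith)
  have h5 : 0 < (n : ℝ) + lam := by linarith
  exact Real.sqrt_pos.2 (by positivity)

/-- Raising `n` by one moves every Gamma argument by 1/2. In the product all Gamma values cancel up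
to two uses of the functional equation, leaving a rational function. -/
theorem alpha_sq_mul_succ (hlam : -1 / 2 < lam) {n : ℕ} (hn : 1 ≤ n) :
    alpha lam n ^ 2 * alpha lam (n + 1) ^ 2 = jacobiSq lam n := by
  have hn' : (1 : ℝ) ≤ n := by exact_mod_cast hn
  have h1 := Real.Gamma_pos_of_pos (show 0 < (n : ℝ) / 2 + 1 by linarith)
  have h2 := Real.Gamma_pos_of_pos (show 0 < (n : ℝ) / 2 + lam + 1 / 2 by linarith)
  have h3 := Real.Gamma_pos_of_pos (show 0 < (n : ℝ) / 2 + 1 / 2 by linarith)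
  have h4 := Real.Gamma_pos_of_pos (show 0 < (n : ℝ) / 2 + lam by linarith)
  have h5 : 0 < (n : ℝ) + lam := by linarith
  have h6 : 0 < (n : ℝ) + 1 + lam := by linarith
  rw [alpha_sq hlam hn, alpha_sq hlam (by omega), jacobiSq]
  push_cast
  rw [show ((n : ℝ) + 1) / 2 + 1 = (n / 2 + 1 / 2) + 1 by ring,
    show ((n : ℝ) + 1) / 2 + lam + 1 / 2 = (n / 2 + lam) + 1 by ring,
    show ((n : ℝ) + 1) / 2 + 1 / 2 = n / 2 + 1 by ring,
    show ((n : ℝ) + 1) / 2 + lam = n / 2 + lam + 1 / 2 by ring,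
    Real.Gamma_add_one (show (n : ℝ) / 2 + 1 / 2 ≠ 0 by linarith),
    Real.Gamma_add_one (show (n : ℝ) / 2 + lam ≠ 0 by linarith)]
  generalize Real.Gamma (n / 2 + 1) = a at *
  generalize Real.Gamma (n / 2 + lam + 1 / 2) = b at *
  generalize Real.Gamma (n / 2 + 1 / 2) = c at *
  generalize Real.Gamma (n / 2 + lam) = d at *
  field_simp

theorem alpha_mul_succ (hlam : -1 / 2 < lam) {n : ℕ} (hn : 1 ≤ n) :
    alpha lam n * alpha lam (n + 1) = √(jacobiSq lam n) := by
  rw [← alpha_sq_mul_succ hlam hn, ← mul_pow, Real.sqrt_sq]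
  exact (mul_pos (alpha_pos hlam hn) (alpha_pos hlam (by omega))).le

theorem alpha_pow_four_le (hlam : -1 / 2 < lam) {n : ℕ} (hn : 1 ≤ n) :
    (alpha lam n ^ 2) ^ 2 ≤ ((n : ℝ) + 1) * (n + 2 * lam) / (n + lam) ^ 2 := by
  have hn' : (1 : ℝ) ≤ n := by exact_mod_cast hn
  have h3 := Real.Gamma_pos_of_pos (show 0 < (n : ℝ) / 2 + 1 / 2 by linarith)
  have h4 := Real.Gamma_pos_of_pos (show 0 < (n : ℝ) / 2 + lam by linarith)
  have h5 : 0 < (n : ℝ) + lam := by linarith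
  have k1 := Gamma_add_half_sq_le (show 0 < (n : ℝ) / 2 + 1 / 2 by linarith)
  have k2 := Gamma_add_half_sq_le (show 0 < (n : ℝ) / 2 + lam by linarith)
  rw [show (n : ℝ) / 2 + 1 / 2 + 1 / 2 = n / 2 + 1 by ring] at k1
  rw [alpha_sq hlam hn, div_pow, div_le_div_iff₀ (by positivity) (by positivity)]
  have := mul_le_mul k1 k2 (sq_nonneg _)
    (mul_nonneg (by linarith) (sq_nonneg _))
  have h6 := mul_le_mul_of_nonneg_left this (show 0 ≤ 4 * ((n : ℝ) + lam) ^ 2 by positivity)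
  linarith

theorem tendsto_natCast_add (a : ℝ) : Tendsto (fun n : ℕ => (n : ℝ) + a) atTop atTop :=
  tendsto_atTop_add_const_right _ _ tendsto_natCast_atTop_atTop

theorem tendsto_natCast_add_div (a b : ℝ) :
    Tendsto (fun n : ℕ => ((n : ℝ) + a) / (n + b)) atTop (𝓝 1) := by
  have h : Tendsto (fun n : ℕ => 1 + (a - b) / ((n : ℝ) + b)) atTop (𝓝 (1 + 0)) :=
    tendsto_const_nhds.add ((tendsto_natCast_add b).const_div_atTop _)
  rw [add_zero] at h
  refine h.congr' ?_
  filter_upwards [(tendsto_natCast_add b).eventually_gt_atTop 0] with n hn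
  field_simp
  ring

theorem tendsto_jacobiSq (lam : ℝ) : Tendsto (jacobiSq lam) atTop (𝓝 1) := by
  have h := (tendsto_natCast_add_div 1 lam).mul (tendsto_natCast_add_div (2 * lam) (1 + lam))
  rw [mul_one] at h
  refine h.congr fun n => ?_
  rw [jacobiSq, div_mul_div_comm, add_assoc (n : ℝ) 1 lam]

/-- Log-convexity bounds `α_n²` above by a sequence tending to 1. Applied to `α_{n+1}²`, the same
bound gives the lower one, as `α_n² = jacobiSq n / α_{n+1}²` and `jacobiSq n → 1`. -/
theorem tendsto_alpha_sq (hlam : -1 / 2 < lam) :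
    Tendsto (fun n => alpha lam n ^ 2) atTop (𝓝 1) := by
  have hb : Tendsto (fun n : ℕ => √(((n : ℝ) + 1) * (n + 2 * lam) / (n + lam) ^ 2))
      atTop (𝓝 1) := by
    have h := (tendsto_natCast_add_div 1 lam).mul (tendsto_natCast_add_div (2 * lam) lam)
    rw [mul_one] at h
    have h' := h.sqrt
    rw [Real.sqrt_one] at h'
    refine h'.congr fun n => ?_
    rw [div_mul_div_comm, sq]
  have hle : ∀ n : ℕ, 1 ≤ n → alpha lam n ^ 2 ≤
      √(((n : ℝ) + 1) * (n + 2 * lam) / (n + lam) ^ 2) := fun n hn =>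
    Real.le_sqrt_of_sq_le (alpha_pow_four_le hlam hn)
  have hl := (tendsto_jacobiSq lam).div (hb.comp (tendsto_add_atTop_nat 1)) one_ne_zero
  rw [div_one] at hl
  refine tendsto_of_tendsto_of_tendsto_of_le_of_le' hl hb ?_ ?_
  · filter_upwards [eventually_ge_atTop 1] with n hn
    have hp := pow_pos (alpha_pos hlam (show 1 ≤ n + 1 by omega)) 2
    have hle1 := hle (n + 1) (by omega)
    simp only [Pi.div_apply, Function.comp_apply]
    rw [← alpha_sq_mul_succ hlam hn, div_le_iff₀ (hp.trans_le hle1)]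
    exact mul_le_mul_of_nonneg_left hle1 (sq_nonneg _)
  · filter_upwards [eventually_ge_atTop 1] with n hn using hle n hn

/-! ### Second-order expansion of `α_n²`. -/

/-- Each term lies below the limit of an increasing subsequence. Steps of two are used because
`α_{n+2}² / α_n²` is the rational function `jacobiSq (n+1) / jacobiSq n`, while neighbours are tied
only through their product. -/
theorem eventually_le_of_le_add_two {y : ℕ → ℝ} {a : ℝ} (hy : Tendsto y atTop (𝓝 a))
    (h : ∀ᶠ n in atTop, y n ≤ y (n + 2)) : ∀ᶠ n in atTop, y n ≤ a := by
  obtain ⟨N, hN⟩ := eventually_atTop.1 h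
  filter_upwards [eventually_ge_atTop N] with n hn
  have hk : ∀ k, y n ≤ y (n + 2 * k) := by
    intro k
    induction k with
    | zero => simp
    | succ k ih => exact ih.trans (hN (n + 2 * k) (by omega))
  have ht : Tendsto (fun k : ℕ => y (n + 2 * k)) atTop (𝓝 a) :=
    hy.comp (tendsto_atTop_mono (fun k => by simp only [id]; omega) tendsto_id)
  exact ge_of_tendsto' ht hk

/-- Truncated asymptotic expansion of `α_n²` in powers of `n + λ`. -/
def alphaApprox (lam K m : ℝ) : ℝ := 1 + lam * (1 - lam) / (2 * m ^ 2) + K / m ^ 4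

theorem eventually_quartic_pos {a : ℝ} (ha : 0 < a) (b c : ℝ) :
    ∀ᶠ M : ℝ in atTop, 0 < a * M ^ 4 + b * M ^ 2 + c := by
  have h1 : Tendsto (fun M : ℝ => a * M ^ 2 + b) atTop atTop :=
    tendsto_atTop_add_const_right _ _ ((tendsto_pow_atTop two_ne_zero).const_mul_atTop ha)
  have h2 : Tendsto (fun M : ℝ => M ^ 2 * (a * M ^ 2 + b) + c) atTop atTop :=
    tendsto_atTop_add_const_right _ _ ((tendsto_pow_atTop two_ne_zero).atTop_mul_atTop₀ h1)
  filter_upwards [h2.eventually_gt_atTop 0] with M hM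
  linarith

theorem jacobiSq_eq (lam : ℝ) (n : ℕ) : jacobiSq lam n =
    (((n : ℝ) + lam) ^ 2 + (n + lam) + lam * (1 - lam)) / ((n + lam) * (n + lam + 1)) := by
  rw [jacobiSq]; ring

/-- The numerator is an even quartic in `m + 1`. With `k = λ(1-λ)`, its leading coefficient `8K + 2k
+ k²` fixes the sign for large `m`, and changes sign at the value of `K` that the expansion of
`α_n²` must have. -/
theorem alphaApprox_cross (lam K m : ℝ) (hm : 0 < m) :
    (alphaApprox lam K m * ((m + 1) ^ 2 + (m + 1) + lam * (1 - lam)) / ((m + 1) * (m + 2))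
      - alphaApprox lam K (m + 2) * (m ^ 2 + m + lam * (1 - lam)) / (m * (m + 1)))
      * (m ^ 4 * (m + 2) ^ 4 * (m + 1))
    = (8 * K + 2 * (lam * (1 - lam)) + (lam * (1 - lam)) ^ 2) * (m + 1) ^ 4 +
      (8 * K - 4 * (lam * (1 - lam)) + 6 * K * (lam * (1 - lam)) - 2 * (lam * (1 - lam)) ^ 2)
        * (m + 1) ^ 2 +
      (2 * (lam * (1 - lam)) + 2 * K * (lam * (1 - lam)) + (lam * (1 - lam)) ^ 2) := by
  rw [alphaApprox, alphaApprox]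
  generalize lam * (1 - lam) = k
  field_simp
  ring

theorem tendsto_alphaApprox (lam K : ℝ) :
    Tendsto (fun n : ℕ => alphaApprox lam K ((n : ℝ) + lam)) atTop (𝓝 1) := by
  have h1 := (((tendsto_pow_atTop (α := ℝ) two_ne_zero).comp (tendsto_natCast_add lam))
    |>.const_mul_atTop (zero_lt_two' ℝ)).const_div_atTop (lam * (1 - lam))
  have h2 := ((tendsto_pow_atTop (α := ℝ) four_ne_zero).comp
    (tendsto_natCast_add lam)).const_div_atTop K
  have := (h1.const_add 1).add h2
  simpa [alphaApprox, Function.comp_def] using this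

theorem alphaApprox_compare (hlam : -1 / 2 < lam) (K : ℝ) (n : ℕ) (hn : 1 ≤ n) :
    alphaApprox lam K (n + lam) * alpha lam (n + 2) ^ 2
      - alphaApprox lam K (n + lam + 2) * alpha lam n ^ 2
    = alpha lam (n + 2) ^ 2 / (jacobiSq lam (n + 1)) *
      (alphaApprox lam K (n + lam) * jacobiSq lam (n + 1)
        - alphaApprox lam K (n + lam + 2) * jacobiSq lam n) := by
  have hp := pow_pos (alpha_pos hlam (show 1 ≤ n + 1 by omega)) 2
  have hp2 := pow_pos (alpha_pos hlam (show 1 ≤ n + 1 + 1 by omega)) 2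
  rw [← alpha_sq_mul_succ hlam hn, ← alpha_sq_mul_succ hlam (show 1 ≤ n + 1 by omega)]
  rw [show n + 1 + 1 = n + 2 from rfl] at *
  generalize alpha lam (n + 1) ^ 2 = x at *
  generalize alpha lam (n + 2) ^ 2 = y at *
  field_simp

theorem alphaApprox_sub (lam K : ℝ) (n : ℕ) (hm : 0 < (n : ℝ) + lam) :
    (alphaApprox lam K (n + lam) * jacobiSq lam (n + 1)
        - alphaApprox lam K (n + lam + 2) * jacobiSq lam n)
      * (((n : ℝ) + lam) ^ 4 * (n + lam + 2) ^ 4 * (n + lam + 1))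
    = (8 * K + 2 * (lam * (1 - lam)) + (lam * (1 - lam)) ^ 2) * (n + (lam + 1)) ^ 4 +
      (8 * K - 4 * (lam * (1 - lam)) + 6 * K * (lam * (1 - lam)) - 2 * (lam * (1 - lam)) ^ 2)
        * (n + (lam + 1)) ^ 2 +
      (2 * (lam * (1 - lam)) + 2 * K * (lam * (1 - lam)) + (lam * (1 - lam)) ^ 2) := by
  have h := alphaApprox_cross lam K (n + lam) hm
  rw [jacobiSq_eq, jacobiSq_eq, ← mul_div_assoc, ← mul_div_assoc]
  push_cast
  rw [show (n : ℝ) + 1 + lam = n + lam + 1 by ring,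
    show (n : ℝ) + lam + 1 + 1 = n + lam + 2 by ring,
    show (n : ℝ) + (lam + 1) = n + lam + 1 by ring]
  exact h

/-- The quotient of `α_n²` by its approximation tends to 1 and, for this sign of the leading
coefficient, is eventually nondecreasing in steps of two. So it is eventually at most 1. -/
theorem eventually_alpha_sq_le (hlam : -1 / 2 < lam) {K : ℝ}
    (hK : 0 < 8 * K + 2 * (lam * (1 - lam)) + (lam * (1 - lam)) ^ 2) :
    ∀ᶠ n : ℕ in atTop, alpha lam n ^ 2 ≤ alphaApprox lam K (n + lam) := by
  have hU := tendsto_alphaApprox lam K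
  have hy : Tendsto (fun n : ℕ => alpha lam n ^ 2 / alphaApprox lam K (n + lam)) atTop (𝓝 1) := by
    have h := (tendsto_alpha_sq hlam).div hU one_ne_zero
    rwa [div_one] at h
  have hUpos := hU.eventually (lt_mem_nhds (zero_lt_one' ℝ))
  have hq := (tendsto_natCast_add (lam + 1)).eventually (eventually_quartic_pos hK
    (8 * K - 4 * (lam * (1 - lam)) + 6 * K * (lam * (1 - lam)) - 2 * (lam * (1 - lam)) ^ 2)
    (2 * (lam * (1 - lam)) + 2 * K * (lam * (1 - lam)) + (lam * (1 - lam)) ^ 2))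
  have := eventually_le_of_le_add_two hy (by
    filter_upwards [hUpos, (tendsto_add_atTop_nat 2).eventually hUpos, hq,
      eventually_ge_atTop 1] with n h1 h2 h3 hn
    have hn' : (1 : ℝ) ≤ n := by exact_mod_cast hn
    have hm : 0 < (n : ℝ) + lam := by linarith
    have hJ : 0 < jacobiSq lam (n + 1) := by
      rw [← alpha_sq_mul_succ hlam (show 1 ≤ n + 1 by omega)]
      exact mul_pos (pow_pos (alpha_pos hlam (by omega)) 2) (pow_pos (alpha_pos hlam (by omega)) 2)
    rw [← alphaApprox_sub lam K n hm] at h3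
    have h4 := pos_of_mul_pos_left h3 (by positivity)
    have h5 : 0 ≤ alpha lam (n + 2) ^ 2 / (jacobiSq lam (n + 1)) := by positivity
    have h6 := mul_nonneg h5 h4.le
    rw [← alphaApprox_compare hlam K n hn] at h6
    rw [show ((n + 2 : ℕ) : ℝ) + lam = n + lam + 2 by push_cast; ring] at h2 ⊢
    rw [div_le_div_iff₀ h1 h2]
    linarith)
  filter_upwards [this, hUpos] with n h1 h2
  rwa [div_le_one h2] at h1

theorem eventually_le_alpha_sq (hlam : -1 / 2 < lam) {K : ℝ}
    (hK : 8 * K + 2 * (lam * (1 - lam)) + (lam * (1 - lam)) ^ 2 < 0) :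
    ∀ᶠ n : ℕ in atTop, alphaApprox lam K (n + lam) ≤ alpha lam n ^ 2 := by
  have hU := tendsto_alphaApprox lam K
  have hy : Tendsto (fun n : ℕ => -(alpha lam n ^ 2 / alphaApprox lam K (n + lam))) atTop
      (𝓝 (-1)) := by
    have h := ((tendsto_alpha_sq hlam).div hU one_ne_zero).neg
    rwa [div_one] at h
  have hUpos := hU.eventually (lt_mem_nhds (zero_lt_one' ℝ))
  have hq := (tendsto_natCast_add (lam + 1)).eventually (eventually_quartic_pos (neg_pos.2 hK)
    (-(8 * K - 4 * (lam * (1 - lam)) + 6 * K * (lam * (1 - lam)) - 2 * (lam * (1 - lam)) ^ 2))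
    (-(2 * (lam * (1 - lam)) + 2 * K * (lam * (1 - lam)) + (lam * (1 - lam)) ^ 2)))
  have := eventually_le_of_le_add_two hy (by
    filter_upwards [hUpos, (tendsto_add_atTop_nat 2).eventually hUpos, hq,
      eventually_ge_atTop 1] with n h1 h2 h3 hn
    have hn' : (1 : ℝ) ≤ n := by exact_mod_cast hn
    have hm : 0 < (n : ℝ) + lam := by linarith
    have hJ : 0 < jacobiSq lam (n + 1) := by
      rw [← alpha_sq_mul_succ hlam (show 1 ≤ n + 1 by omega)]
      exact mul_pos (pow_pos (alpha_pos hlam (by omega)) 2) (pow_pos (alpha_pos hlam (by omega)) 2)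
    have h3' := alphaApprox_sub lam K n hm
    have h4 : (alphaApprox lam K (n + lam) * jacobiSq lam (n + 1)
        - alphaApprox lam K (n + lam + 2) * jacobiSq lam n) ≤ 0 := by
      by_contra! hc
      have := mul_pos hc
        (show 0 < ((n : ℝ) + lam) ^ 4 * (n + lam + 2) ^ 4 * (n + lam + 1) by positivity)
      rw [h3'] at this
      linarith
    have h5 : 0 ≤ alpha lam (n + 2) ^ 2 / (jacobiSq lam (n + 1)) := by positivity
    have h6 := mul_nonpos_of_nonneg_of_nonpos h5 h4
    rw [← alphaApprox_compare hlam K n hn] at h6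
    rw [show ((n + 2 : ℕ) : ℝ) + lam = n + lam + 2 by push_cast; ring] at h2 ⊢
    rw [neg_le_neg_iff, div_le_div_iff₀ h2 h1]
    linarith)
  filter_upwards [this, hUpos] with n h1 h2
  rwa [neg_le_neg_iff, one_le_div h2] at h1

/-- The error of the second order expansion of `α_n²` is `o(n⁻³)`. -/
theorem tendsto_alpha_error (hlam : -1 / 2 < lam) :
    Tendsto (fun n : ℕ => ((n : ℝ) + lam) ^ 3 * (alpha lam n ^ 2 - 1 -
      lam * (1 - lam) / (2 * ((n : ℝ) + lam) ^ 2))) atTop (𝓝 0) := by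
  set k := lam * (1 - lam) with hk
  -- The two values of `K` make the leading coefficient `8K + 2k + k²` equal to `1` and `-1`, so
  -- they enclose the true coefficient of `m⁻⁴`.
  have h1 := eventually_alpha_sq_le hlam (K := (1 - 2 * k - k ^ 2) / 8) (by rw [← hk]; linarith)
  have h2 := eventually_le_alpha_sq hlam (K := (-1 - 2 * k - k ^ 2) / 8) (by rw [← hk]; linarith)
  refine tendsto_of_tendsto_of_tendsto_of_le_of_le'
    ((tendsto_natCast_add lam).const_div_atTop ((-1 - 2 * k - k ^ 2) / 8))
    ((tendsto_natCast_add lam).const_div_atTop ((1 - 2 * k - k ^ 2) / 8)) ?_ ?_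
  · filter_upwards [h2, eventually_ge_atTop 1] with n h hn
    have hn' : (1 : ℝ) ≤ n := by exact_mod_cast hn
    have hm : 0 < (n : ℝ) + lam := by linarith
    rw [alphaApprox, ← hk] at h
    calc _ = ((n : ℝ) + lam) ^ 3 * ((-1 - 2 * k - k ^ 2) / 8 / ((n : ℝ) + lam) ^ 4) := by
          field_simp
      _ ≤ _ := mul_le_mul_of_nonneg_left (by linarith) (by positivity)
  · filter_upwards [h1, eventually_ge_atTop 1] with n h hn
    have hn' : (1 : ℝ) ≤ n := by exact_mod_cast hn
    have hm : 0 < (n : ℝ) + lam := by linarith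
    rw [alphaApprox, ← hk] at h
    calc _ ≤ ((n : ℝ) + lam) ^ 3 * ((1 - 2 * k - k ^ 2) / 8 / ((n : ℝ) + lam) ^ 4) :=
          mul_le_mul_of_nonneg_left (by linarith) (by positivity)
      _ = _ := by field_simp

/-! ### Asymptotics of `β_λ(n)` and existence of the threshold. -/

theorem tendsto_beta_error (hlam : -1 / 2 < lam) :
    Tendsto (fun n : ℕ => (n : ℝ) * (beta lam n - betaInf lam)) atTop (𝓝 (lam / 4)) := by
  have hE := tendsto_alpha_error hlam
  have hx := tendsto_alpha_sq hlam
  have r0 := tendsto_natCast_add_div 0 lam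
  have r2 := tendsto_natCast_add_div (2 * lam) lam
  have i1 := (tendsto_natCast_add lam).const_div_atTop (lam * (1 - lam) * lam ^ 2 / 2)
  have i2 := hE.mul (((tendsto_natCast_add lam).const_div_atTop 1).pow 2)
  have i3 := (tendsto_natCast_add lam).const_div_atTop (lam * (1 - lam) / 2)
  -- With `m = n + λ` and `k = λ(1-λ)`, one has `n(n+2λ) = m² - λ²`. The terms of order `n` cancel
  -- because `1/8 - k/2 = β_λ(∞)`. Of the rest only `α_n² λ/4` survives; it comes from the `2λ` in
  -- `α_n²(n+2λ)/8`.
  have := ((((hE.mul (r0.pow 2)).mul r2).neg.add (i1.mul r0)).add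
    ((i2.add i3).mul (r0.mul_const (1 / 8)))).add (hx.mul_const (lam / 4))
  have h2 : (-(0 * 1 ^ 2 * 1) + 0 * 1 + (0 * 0 ^ 2 + 0) * (1 * (1 / 8)) + 1 * (lam / 4) : ℝ)
      = lam / 4 := by ring
  rw [h2] at this
  refine this.congr' ?_
  filter_upwards [eventually_ge_atTop 1] with n hn
  have hn' : (1 : ℝ) ≤ n := by exact_mod_cast hn
  have hm : 0 < (n : ℝ) + lam := by linarith
  rw [beta, betaInf]
  generalize alpha lam n ^ 2 = x
  field_simp
  ring

theorem tendsto_beta (hlam : -1 / 2 < lam) :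
    Tendsto (beta lam) atTop (𝓝 (betaInf lam)) := by
  have h := (tendsto_beta_error hlam).mul (tendsto_const_div_atTop_nhds_zero_nat (1 : ℝ))
  rw [mul_zero] at h
  have h' := h.add_const (betaInf lam)
  rw [zero_add] at h'
  refine h'.congr' ?_
  filter_upwards [eventually_ge_atTop 1] with n hn
  have hn' : (1 : ℝ) ≤ n := by exact_mod_cast hn
  field_simp
  ring

theorem beta_zero_left {n : ℕ} (hn : 1 ≤ n) : beta 0 n = betaInf 0 := by
  have hn' : (1 : ℝ) ≤ n := by exact_mod_cast hn
  have h3 := Real.Gamma_pos_of_pos (show 0 < (n : ℝ) / 2 + 1 / 2 by linarith)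
  have h4 := Real.Gamma_pos_of_pos (show 0 < (n : ℝ) / 2 by linarith)
  have h : alpha 0 n ^ 2 = 1 := by
    rw [alpha_sq (by norm_num) hn, Real.Gamma_add_one (show (n : ℝ) / 2 ≠ 0 by linarith)]
    simp only [add_zero]
    field_simp
  rw [beta, betaInf, h]
  field_simp
  ring

theorem eventually_betaInf_le_beta (hlam : 0 ≤ lam) :
    ∀ᶠ n : ℕ in atTop, betaInf lam ≤ beta lam n := by
  rcases hlam.eq_or_lt with rfl | hpos
  · filter_upwards [eventually_ge_atTop 1] with n hn using (beta_zero_left hn).ge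
  · have h := (tendsto_beta_error (show -1 / 2 < lam by linarith)).eventually
      (lt_mem_nhds (show 0 < lam / 4 by linarith))
    filter_upwards [h] with n hn
    have := pos_of_mul_pos_right hn (Nat.cast_nonneg n)
    linarith

theorem exists_isThreshold (hlam : 0 ≤ lam) : ∃ N : ℕ, IsThreshold lam N := by
  classical
  have hne : ∃ N : ℕ, IsGLB (beta lam '' {n : ℕ | 1 ≤ n ∧ N ≤ n}) (betaInf lam) := by
    obtain ⟨N, hN⟩ := eventually_atTop.1 (eventually_betaInf_le_beta hlam)
    refine ⟨N, ?_, ?_⟩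
    · rintro _ ⟨n, ⟨-, hn⟩, rfl⟩
      exact hN n hn
    · intro b hb
      refine ge_of_tendsto (tendsto_beta (show -1 / 2 < lam by linarith)) ?_
      filter_upwards [eventually_ge_atTop (max 1 N)] with n hn
      exact hb ⟨n, ⟨(le_max_left _ _).trans hn, (le_max_right _ _).trans hn⟩, rfl⟩
  exact ⟨Nat.find hne, Nat.find_spec hne, fun m hm => Nat.find_min' hne hm⟩

theorem IsThreshold.le_beta {N n : ℕ} (h : IsThreshold lam N) (hn : 1 ≤ n) (hN : N ≤ n) :
    betaInf lam ≤ beta lam n :=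
  h.1.1 ⟨n, ⟨hn, hN⟩, rfl⟩

/-! ### The discrete Hardy inequality. -/

/-- With `h = 1/(k+1)` this is `√(1+h) + √(1-h) ≤ 2 - h²/4`. Squaring reduces it to `√(1-h²) ≤ 1 -
h²/2`. -/
theorem sqrt_add_sqrt_le_hardy (k : ℕ) :
    √(((k : ℝ) + 2) / (k + 1)) + √((k : ℝ) / (k + 1)) ≤ 2 * (1 - 1 / (8 * ((k : ℝ) + 1) ^ 2)) := by
  set h : ℝ := 1 / ((k : ℝ) + 1) with hh
  have hk : (0 : ℝ) ≤ k := Nat.cast_nonneg k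
  have h0 : 0 < h := by positivity
  have h1 : h ≤ 1 := by rw [hh, div_le_one (by positivity)]; linarith
  have e1 : ((k : ℝ) + 2) / (k + 1) = 1 + h := by rw [hh]; field_simp; ring
  have e2 : (k : ℝ) / (k + 1) = 1 - h := by rw [hh]; field_simp; ring
  have e3 : 1 / (8 * ((k : ℝ) + 1) ^ 2) = h ^ 2 / 8 := by rw [hh]; field_simp
  rw [e1, e2, e3]
  have hp : √(1 + h) * √(1 - h) ≤ 1 - h ^ 2 / 2 := by
    rw [← Real.sqrt_mul (by linarith)]
    refine Real.sqrt_le_iff.2 ⟨by nlinarith, ?_⟩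
    nlinarith [sq_nonneg (h ^ 2)]
  refine abs_le_of_sq_le_sq' ?_ (by nlinarith) |>.2
  have s1 := Real.sq_sqrt (show 0 ≤ 1 + h by linarith)
  have s2 := Real.sq_sqrt (show 0 ≤ 1 - h by linarith)
  nlinarith [sq_nonneg (h ^ 2)]

/-- Discrete Hardy inequality in product form. -/
theorem tsum_mul_succ_le_hardy {d : ℕ → ℝ} (hd : Summable fun k => d k ^ 2) :
    (Summable fun k => d k * d (k + 1)) ∧
    ∑' k, d k * d (k + 1) ≤ ∑' k : ℕ, (1 - 1 / (8 * ((k : ℝ) + 1) ^ 2)) * d k ^ 2 := by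
  -- Weights for the arithmetic-geometric mean inequality, taken from the ground state `√n` with `n
  -- = k + 1`: `s = √(n+1)/√n` and `t = √(n-1)/√n`. As `t 0 = 0`, shifting the index leaves no
  -- boundary term.
  set s : ℕ → ℝ := fun k => √(((k : ℝ) + 2) / (k + 1)) with hs
  set t : ℕ → ℝ := fun k => √((k : ℝ) / (k + 1)) with ht
  have hst : ∀ k, s k * t (k + 1) = 1 := by
    intro k
    simp only [hs, ht]
    rw [← Real.sqrt_mul (by positivity)]
    push_cast
    rw [show ((k : ℝ) + 2) / (k + 1) * ((k + 1) / (k + 1 + 1)) = 1 by field_simp; ring,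
      Real.sqrt_one]
  have hs2 : ∀ k, s k ≤ 2 := by
    intro k
    have hk : (0 : ℝ) ≤ k := Nat.cast_nonneg k
    refine Real.sqrt_le_iff.2 ⟨by norm_num, ?_⟩
    rw [div_le_iff₀ (by positivity)]; linarith
  have ht1 : ∀ k, t k ≤ 1 := by
    intro k
    refine Real.sqrt_le_one.2 ?_
    rw [div_le_one (by positivity)]; linarith
  have hs0 : ∀ k, 0 ≤ s k := fun k => Real.sqrt_nonneg _
  have ht0 : ∀ k, 0 ≤ t k := fun k => Real.sqrt_nonneg _
  have hsum1 : Summable fun k => s k * d k ^ 2 :=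
    (hd.mul_left 2).of_nonneg_of_le (fun k => mul_nonneg (hs0 k) (sq_nonneg _))
      (fun k => mul_le_mul_of_nonneg_right (hs2 k) (sq_nonneg _))
  have hsum2 : Summable fun k => t k * d k ^ 2 :=
    hd.of_nonneg_of_le (fun k => mul_nonneg (ht0 k) (sq_nonneg _))
      (fun k => mul_le_of_le_one_left (sq_nonneg _) (ht1 k))
  have hsum3 : Summable fun k => t (k + 1) * d (k + 1) ^ 2 :=
    (summable_nat_add_iff (f := fun k => t k * d k ^ 2) 1).2 hsum2
  have hshift : ∑' k, t (k + 1) * d (k + 1) ^ 2 = ∑' k, t k * d k ^ 2 := by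
    rw [hsum2.tsum_eq_zero_add]
    simp [ht]
  have hterm : ∀ k, |d k * d (k + 1)| ≤ (s k * d k ^ 2 + t (k + 1) * d (k + 1) ^ 2) / 2 := by
    intro k
    have h1 : 0 < s k := by
      rcases (hs0 k).eq_or_lt with h | h
      · have := hst k; rw [← h, zero_mul] at this; norm_num at this
      · exact h
    have h2 : t (k + 1) = 1 / s k := by rw [eq_div_iff h1.ne', mul_comm]; exact hst k
    rw [h2, abs_mul, ← sq_abs (d k), ← sq_abs (d (k + 1))]
    have h3 : (s k * |d k| ^ 2 + 1 / s k * |d (k + 1)| ^ 2) / 2 - |d k| * |d (k + 1)|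
        = (s k * |d k| - |d (k + 1)|) ^ 2 / (2 * s k) := by field_simp; ring
    have h4 : 0 ≤ (s k * |d k| - |d (k + 1)|) ^ 2 / (2 * s k) := by positivity
    linarith
  have hb := (hsum1.add hsum3).div_const 2
  have hsm : Summable fun k => d k * d (k + 1) :=
    (hb.of_nonneg_of_le (fun k => abs_nonneg _) hterm).of_abs
  refine ⟨hsm, ?_⟩
  calc ∑' k, d k * d (k + 1)
      ≤ ∑' k, (s k * d k ^ 2 + t (k + 1) * d (k + 1) ^ 2) / 2 :=
        hsm.tsum_le_tsum (fun k => (le_abs_self _).trans (hterm k)) hb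
    _ = (∑' k, s k * d k ^ 2 + ∑' k, t k * d k ^ 2) / 2 := by
        rw [tsum_div_const, hsum1.tsum_add hsum3, hshift]
    _ = ∑' k, (s k * d k ^ 2 + t k * d k ^ 2) / 2 := by
        rw [tsum_div_const, hsum1.tsum_add hsum2]
    _ ≤ _ := by
        refine ((hsum1.add hsum2).div_const 2).tsum_le_tsum (fun k => ?_) ?_
        · have := mul_le_mul_of_nonneg_right (sqrt_add_sqrt_le_hardy k) (sq_nonneg (d k))
          simp only [hs, ht]
          linarith
        · refine hd.of_nonneg_of_le (fun k => mul_nonneg ?_ (sq_nonneg _))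
            (fun k => mul_le_of_le_one_left (sq_nonneg _) ?_)
          · rw [sub_nonneg, div_le_one (by positivity)]
            have hk : (0 : ℝ) ≤ k := Nat.cast_nonneg k
            nlinarith
          · linarith [show 0 ≤ 1 / (8 * ((k : ℝ) + 1) ^ 2) by positivity]

/-! ### Optimality of Hardy's constant. -/

/-- The harmonic numbers as reals. -/
def harm (n : ℕ) : ℝ := ∑ i ∈ Finset.range n, 1 / ((i : ℝ) + 1)

theorem harm_succ (n : ℕ) : harm (n + 1) = harm n + 1 / ((n : ℝ) + 1) :=
  Finset.sum_range_succ _ _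

theorem monotone_harm : Monotone harm :=
  monotone_nat_of_le_succ fun n => by
    rw [harm_succ]; linarith [show 0 ≤ 1 / ((n : ℝ) + 1) by positivity]

theorem tendsto_harm : Tendsto harm atTop atTop :=
  Real.tendsto_sum_range_one_div_nat_succ_atTop

/-- Cut-off equal to `1` up to `P`, then decaying like the harmonic numbers. -/
def harmCutoff (P n : ℕ) : ℝ := min 1 (max 0 (1 + harm P - harm n))

theorem harmCutoff_nonneg (P n : ℕ) : 0 ≤ harmCutoff P n :=
  le_min zero_le_one (le_max_left _ _)

theorem harmCutoff_le_one (P n : ℕ) : harmCutoff P n ≤ 1 := min_le_left _ _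

theorem harmCutoff_of_le {P n : ℕ} (h : n ≤ P) : harmCutoff P n = 1 := by
  have := monotone_harm h
  exact min_eq_left (le_max_of_le_right (by linarith))

theorem harmCutoff_of_ge {P n : ℕ} (h : harm P + 1 ≤ harm n) : harmCutoff P n = 0 := by
  rw [harmCutoff, max_eq_left (by linarith), min_eq_right zero_le_one]

theorem harmCutoff_succ_le (P n : ℕ) : harmCutoff P (n + 1) ≤ harmCutoff P n := by
  have := monotone_harm n.le_succ
  exact min_le_min_left _ (max_le_max_left _ (by linarith))

theorem harmCutoff_sub_succ_le (P n : ℕ) :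
    harmCutoff P n - harmCutoff P (n + 1) ≤ 1 / ((n : ℝ) + 1) := by
  have h : 0 ≤ 1 / ((n : ℝ) + 1) := by positivity
  have : max 0 (1 + harm P - harm n) ≤ max 0 (1 + harm P - harm (n + 1)) + 1 / ((n : ℝ) + 1) := by
    rw [harm_succ]
    refine max_le ?_ ?_
    · linarith [le_max_left (0 : ℝ) (1 + harm P - (harm n + 1 / ((n : ℝ) + 1)))]
    · linarith [le_max_right (0 : ℝ) (1 + harm P - (harm n + 1 / ((n : ℝ) + 1)))]
  rw [sub_le_iff_le_add, harmCutoff, harmCutoff]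
  rcases min_choice 1 (max 0 (1 + harm P - harm (n + 1))) with h1 | h1 <;> rw [h1]
  · linarith [min_le_left 1 (max 0 (1 + harm P - harm n))]
  · linarith [min_le_right 1 (max 0 (1 + harm P - harm n))]

/-- The main term is the Hardy term of `√n`, since `(√(n+1) - √n)² ≤ 1/(4n)`. The cutoff drops by at
most `1/(n+1)`, so its cost `(n+1)(x-y)²` is at most `x - y`, which telescopes when summed. -/
theorem sqrt_mul_cutoff_diff_sq_le {δ : ℝ} (hδ : 0 < δ) (P : ℕ) {n : ℕ} (hn : 1 ≤ n) :
    (√((n : ℝ) + 1) * harmCutoff P (n + 1) - √n * harmCutoff P n) ^ 2 ≤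
      (1 + δ) / 4 * ((√n * harmCutoff P n) ^ 2 / (n : ℝ) ^ 2)
        + (1 + 1 / δ) * (harmCutoff P n - harmCutoff P (n + 1)) := by
  have hn' : (1 : ℝ) ≤ n := by exact_mod_cast hn
  have hn0 : (0 : ℝ) < n := by linarith
  have t0 := harmCutoff_nonneg P n
  have t2 := harmCutoff_succ_le P n
  have t3 := harmCutoff_sub_succ_le P n
  generalize harmCutoff P n = x at *
  generalize harmCutoff P (n + 1) = y at *
  have s1 := Real.sq_sqrt hn0.le
  have s2 := Real.sq_sqrt (show 0 ≤ (n : ℝ) + 1 by linarith)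
  have p1 := Real.sqrt_pos.2 hn0
  have p2 : √(n : ℝ) ≤ √((n : ℝ) + 1) := Real.sqrt_le_sqrt (by linarith)
  generalize √(n : ℝ) = u at *
  generalize √((n : ℝ) + 1) = v at *
  have huv : (v - u) ^ 2 ≤ 1 / (4 * n) := by
    have : (v - u) * (v + u) = 1 := by linarith
    have h2 : 0 ≤ v - u := by linarith
    have h3 : (v - u) * (2 * u) ≤ 1 := by nlinarith
    rw [le_div_iff₀ (by positivity), ← s1]
    nlinarith [mul_nonneg h2 p1.le]
  have hy : v ^ 2 * (x - y) ^ 2 ≤ x - y := by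
    rw [s2]
    rw [le_div_iff₀ (by positivity)] at t3
    nlinarith [mul_le_mul_of_nonneg_left t3 (sub_nonneg.2 t2)]
  have e : v * y - u * x = (v - u) * x - v * (x - y) := by ring
  have key : ((v - u) * x - v * (x - y)) ^ 2 ≤
      (1 + δ) * ((v - u) * x) ^ 2 + (1 + 1 / δ) * (v * (x - y)) ^ 2 := by
    generalize (v - u) * x = a
    generalize v * (x - y) = b
    have : (1 + δ) * a ^ 2 + (1 + 1 / δ) * b ^ 2 - (a - b) ^ 2 = (δ * a + b) ^ 2 / δ := by
      field_simp; ring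
    have h2 : 0 ≤ (δ * a + b) ^ 2 / δ := by positivity
    linarith
  rw [e]
  refine key.trans (add_le_add ?_ ?_)
  · rw [mul_pow, mul_pow, s1, div_mul_eq_mul_div, mul_div_assoc]
    refine mul_le_mul_of_nonneg_left ?_ (by linarith)
    calc (v - u) ^ 2 * x ^ 2 ≤ 1 / (4 * n) * x ^ 2 :=
          mul_le_mul_of_nonneg_right huv (sq_nonneg _)
      _ = _ := by field_simp
  · rw [mul_pow]
    exact mul_le_mul_of_nonneg_left hy (by positivity)

/-- The constant in the discrete Hardy inequality cannot be improved, not even on finitely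
supported sequences vanishing up to a given index. -/
theorem exists_hardy_near_extremal {δ : ℝ} (hδ : 0 < δ) (M : ℕ) :
    ∃ (c : ℕ → ℝ) (R : ℕ), (∀ n ≤ M, c n = 0) ∧ (∀ n, R ≤ n → c n = 0) ∧
      0 < ∑ n ∈ Finset.range R, c n ^ 2 / (n : ℝ) ^ 2 ∧
      ∑ n ∈ Finset.range R, (c (n + 1) - c n) ^ 2 ≤
        (1 / 4 + δ) * ∑ n ∈ Finset.range R, c n ^ 2 / (n : ℝ) ^ 2 := by
  -- `T` bounds all errors independently of `P`: the telescoped cutoff cost, plus the jump from 0 at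
  -- `n = M`. Divergence of the harmonic series then makes the Hardy sum exceed `2T/δ`, which
  -- absorbs them.
  set T : ℝ := (1 + 1 / (2 * δ)) + (M + 1) with hT
  have hTpos : 0 < T := by positivity
  obtain ⟨P, hP⟩ := (tendsto_harm.eventually_ge_atTop (harm M + 2 * T / δ)).exists
  obtain ⟨R, hR, hRP⟩ := ((tendsto_harm.eventually_ge_atTop (harm P + 1)).and
    (eventually_gt_atTop P)).exists
  set c : ℕ → ℝ := fun n => if n ≤ M then 0 else √n * harmCutoff P n with hc
  have hc0 : ∀ n ≤ M, c n = 0 := fun n hn => by simp only [hc, if_pos hn]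
  have hc1 : ∀ n, M < n → c n = √n * harmCutoff P n := fun n hn => by
    simp only [hc, if_neg (not_le.2 hn)]
  have hcR : ∀ n, R ≤ n → c n = 0 := by
    intro n hn
    rcases le_or_gt n M with h | h
    · exact hc0 n h
    · rw [hc1 n h, harmCutoff_of_ge (hR.trans (monotone_harm hn)), mul_zero]
  set S := ∑ n ∈ Finset.range R, c n ^ 2 / (n : ℝ) ^ 2 with hS
  have hlow : ∀ p ≤ P, harm p - harm M ≤ ∑ n ∈ Finset.range (p + 1), c n ^ 2 / (n : ℝ) ^ 2 := by
    intro p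
    induction p with
    | zero =>
      intro _
      have := monotone_harm (Nat.zero_le M)
      exact (by linarith : harm 0 - harm M ≤ 0).trans
        (Finset.sum_nonneg fun n _ => by positivity)
    | succ p ih =>
      intro hp
      rcases lt_or_ge p M with h | h
      · have := monotone_harm (show p + 1 ≤ M from h)
        exact (by linarith : harm (p + 1) - harm M ≤ 0).trans
          (Finset.sum_nonneg fun n _ => by positivity)
      · rw [Finset.sum_range_succ, harm_succ, hc1 _ (by omega), harmCutoff_of_le hp, mul_one,
          Real.sq_sqrt (by positivity)]
        have := ih (by omega)
        have h2 : (((p + 1 : ℕ) : ℝ)) / ((p + 1 : ℕ) : ℝ) ^ 2 = 1 / ((p : ℝ) + 1) := by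
          push_cast; field_simp
        rw [h2]
        linarith
  have hSlow : 2 * T / δ ≤ S := by
    have h1 := hlow P le_rfl
    have h2 : ∑ n ∈ Finset.range (P + 1), c n ^ 2 / (n : ℝ) ^ 2 ≤ S :=
      Finset.sum_le_sum_of_subset_of_nonneg (Finset.range_mono hRP)
        (fun n _ _ => by positivity)
    linarith
  have hterm : ∀ n, (c (n + 1) - c n) ^ 2 ≤ (1 + 2 * δ) / 4 * (c n ^ 2 / (n : ℝ) ^ 2)
      + (1 + 1 / (2 * δ)) * (harmCutoff P n - harmCutoff P (n + 1))
      + (if n = M then (M : ℝ) + 1 else 0) := by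
    intro n
    have hnn : 0 ≤ (1 + 1 / (2 * δ)) * (harmCutoff P n - harmCutoff P (n + 1)) :=
      mul_nonneg (by positivity) (sub_nonneg.2 (harmCutoff_succ_le P n))
    rcases lt_trichotomy n M with h | h | h
    · rw [hc0 n h.le, hc0 (n + 1) h, if_neg h.ne]
      simpa using hnn
    · rw [if_pos h, hc0 n h.le, hc1 (n + 1) (by omega), sub_zero, mul_pow,
        Real.sq_sqrt (by positivity), h]
      have h3 : ((M + 1 : ℕ) : ℝ) * harmCutoff P (M + 1) ^ 2 ≤ (M : ℝ) + 1 := by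
        push_cast
        exact mul_le_of_le_one_right (by positivity)
          (pow_le_one₀ (harmCutoff_nonneg _ _) (harmCutoff_le_one _ _))
      rw [h] at hnn
      rw [zero_pow two_ne_zero, zero_div, mul_zero, zero_add]
      linarith
    · rw [hc1 n h, hc1 (n + 1) (by omega), if_neg h.ne', add_zero]
      have := sqrt_mul_cutoff_diff_sq_le (show 0 < 2 * δ by positivity) P (n := n) (by omega)
      push_cast
      exact this
  refine ⟨c, R, hc0, hcR, lt_of_lt_of_le (by positivity) hSlow, ?_⟩
  calc ∑ n ∈ Finset.range R, (c (n + 1) - c n) ^ 2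
      ≤ ∑ n ∈ Finset.range R, ((1 + 2 * δ) / 4 * (c n ^ 2 / (n : ℝ) ^ 2)
        + (1 + 1 / (2 * δ)) * (harmCutoff P n - harmCutoff P (n + 1))
        + (if n = M then (M : ℝ) + 1 else 0)) := Finset.sum_le_sum fun n _ => hterm n
    _ ≤ (1 + 2 * δ) / 4 * S + (1 + 1 / (2 * δ)) * 1 + (M + 1) := by
        rw [Finset.sum_add_distrib, Finset.sum_add_distrib, ← Finset.mul_sum, ← Finset.mul_sum,
          Finset.sum_range_sub', Finset.sum_ite_eq']
        refine add_le_add (add_le_add le_rfl (mul_le_mul_of_nonneg_left ?_ (by positivity))) ?_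
        · linarith [harmCutoff_le_one P 0, harmCutoff_nonneg P R]
        · split_ifs
          · exact le_rfl
          · positivity
    _ ≤ (1 / 4 + δ) * S := by
        rw [div_le_iff₀ hδ] at hSlow
        linarith

/-- Near-extremal finitely supported coefficient sequences for the Jacobi form. -/
theorem exists_jacobi_near_extremal {lam : ℝ} (hlam : -1 / 2 < lam) {ε : ℝ} (hε : 0 < ε)
    (n₀ : ℕ) :
    ∃ (a : ℕ → ℝ) (R : ℕ), (∀ n ≤ n₀, a n = 0) ∧ (∀ n, R ≤ n → a n = 0) ∧
      0 < ∑ n ∈ Finset.range R, a n ^ 2 / ((n : ℝ) * (n + 2 * lam)) ∧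
      ∑ n ∈ Finset.range R, a n ^ 2
          - ∑ n ∈ Finset.range R, √(jacobiSq lam n) * (a n * a (n + 1)) ≤
        (betaInf lam + ε) * ∑ n ∈ Finset.range R, a n ^ 2 / ((n : ℝ) * (n + 2 * lam)) := by
  have ev1 := (tendsto_beta hlam).eventually (gt_mem_nhds
    (show betaInf lam < betaInf lam + ε / 2 by linarith))
  -- The bound 2 (the limit is 1) compares `c²/n²` with the weighted sum of `(c/α)²`. Half the Hardy
  -- defect `ε/2`, times 2, uses up the remaining `ε/2`.
  have ev2 : ∀ᶠ n : ℕ in atTop, alpha lam n ^ 2 * (((n : ℝ) + 2 * lam) / (n + 0)) < 2 :=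
    ((tendsto_alpha_sq hlam).mul (tendsto_natCast_add_div (2 * lam) 0)).eventually
      (gt_mem_nhds (by norm_num))
  obtain ⟨M, hM⟩ := eventually_atTop.1 ((ev1.and ev2).and (eventually_ge_atTop (n₀ + 1)))
  have hM1 : n₀ + 1 ≤ M := (hM M le_rfl).2
  obtain ⟨c, R, hc0, hcR, hS, hle⟩ := exists_hardy_near_extremal (δ := ε / 2) (by positivity) M
  have hpos : ∀ n, M < n → 0 < (n : ℝ) * (n + 2 * lam) := by
    intro n hn
    have hn' : (1 : ℝ) ≤ n := by exact_mod_cast (show 1 ≤ n by omega)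
    exact mul_pos (by linarith) (by linarith)
  have hterm : ∀ n, c n ^ 2 / (n : ℝ) ^ 2 ≤
      2 * ((c n / alpha lam n) ^ 2 / ((n : ℝ) * (n + 2 * lam))) := by
    intro n
    rcases le_or_gt n M with h | h
    · simp [hc0 n h]
    · have hn' : (1 : ℝ) ≤ n := by exact_mod_cast (show 1 ≤ n by omega)
      have hα := alpha_pos hlam (show 1 ≤ n by omega)
      have h2 := (hM n h.le).1.2.le
      have h3 : 0 < (n : ℝ) + 2 * lam := by linarith
      have h4 : 0 ≤ (c n / alpha lam n) ^ 2 / ((n : ℝ) * (n + 2 * lam)) := by positivity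
      refine le_trans (le_of_eq ?_) (mul_le_mul_of_nonneg_right h2 h4)
      rw [add_zero]
      field_simp
  have hterm2 : ∀ n, (c n / alpha lam n) ^ 2 - c n ^ 2 + c n ^ 2 / (n : ℝ) ^ 2 / 8 ≤
      (betaInf lam + ε / 2) * ((c n / alpha lam n) ^ 2 / ((n : ℝ) * (n + 2 * lam))) := by
    intro n
    rcases le_or_gt n M with h | h
    · simp [hc0 n h]
    · have hn' : (1 : ℝ) ≤ n := by exact_mod_cast (show 1 ≤ n by omega)
      have hα := alpha_pos hlam (show 1 ≤ n by omega)
      have h2 := (hM n h.le).1.1.le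
      have h3 : 0 < (n : ℝ) + 2 * lam := by linarith
      have h4 : 0 ≤ (c n / alpha lam n) ^ 2 / ((n : ℝ) * (n + 2 * lam)) := by positivity
      refine le_trans (le_of_eq ?_) (mul_le_mul_of_nonneg_right h2 h4)
      rw [beta]
      field_simp
  have hsum1 := Finset.sum_le_sum fun n (_ : n ∈ Finset.range R) => hterm n
  have hsum2 := Finset.sum_le_sum fun n (_ : n ∈ Finset.range R) => hterm2 n
  rw [← Finset.mul_sum] at hsum1 hsum2
  rw [Finset.sum_add_distrib, Finset.sum_sub_distrib, ← Finset.sum_div] at hsum2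
  refine ⟨fun n => c n / alpha lam n, R, fun n hn => by simp [hc0 n (by omega)],
    fun n hn => by simp [hcR n hn], by linarith, ?_⟩
  have hprod : ∑ n ∈ Finset.range R, √(jacobiSq lam n) *
      (c n / alpha lam n * (c (n + 1) / alpha lam (n + 1))) =
      ∑ n ∈ Finset.range R, c n * c (n + 1) := by
    refine Finset.sum_congr rfl fun n _ => ?_
    rcases Nat.eq_zero_or_pos n with h | h
    · simp [hc0 n (by omega)]
    · rw [← alpha_mul_succ hlam h]
      have h1 := alpha_pos hlam h
      have h2 := alpha_pos hlam (show 1 ≤ n + 1 by omega)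
      field_simp
  have hshift : ∑ n ∈ Finset.range R, c (n + 1) ^ 2 = ∑ n ∈ Finset.range R, c n ^ 2 := by
    have h1 := Finset.sum_range_succ (fun n => c n ^ 2) R
    rw [Finset.sum_range_succ', hc0 0 (Nat.zero_le _), hcR R le_rfl] at h1
    simpa using h1
  have hdiff : ∑ n ∈ Finset.range R, (c (n + 1) - c n) ^ 2 =
      2 * ∑ n ∈ Finset.range R, c n ^ 2 - 2 * ∑ n ∈ Finset.range R, c n * c (n + 1) := by
    rw [two_mul (∑ n ∈ Finset.range R, c n ^ 2)]
    nth_rewrite 1 [← hshift]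
    rw [Finset.mul_sum, ← Finset.sum_add_distrib, ← Finset.sum_sub_distrib]
    exact Finset.sum_congr rfl fun n _ => by ring
  rw [hprod]
  rw [hdiff] at hle
  have hmul := mul_le_mul_of_nonneg_left hsum1 (show 0 ≤ ε / 4 by positivity)
  simp only at *
  linarith

/-! ### The weighted measure on `[-1, 1]`. -/

theorem intervalIntegrable_weight (hlam : -1 / 2 < lam) :
    IntervalIntegrable (weight lam) volume (-1) 1 := by
  have ha : -1 < lam - 1 / 2 := by linarith
  have hbase : IntervalIntegrable (fun x : ℝ => x ^ (lam - 1 / 2)) volume 1 0 :=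
    intervalIntegral.intervalIntegrable_rpow' ha
  have h1 : IntervalIntegrable (fun x : ℝ => (1 - x) ^ (lam - 1 / 2)) volume 0 1 := by
    simpa using hbase.comp_sub_left 1
  have h2 : IntervalIntegrable (fun x : ℝ => (1 + x) ^ (lam - 1 / 2)) volume (-1) 0 := by
    have := hbase.symm.comp_add_left 1
    simpa using this
  have hr : IntervalIntegrable (weight lam) volume 0 1 := by
    have hc : ContinuousOn (fun x : ℝ => (1 + x) ^ (lam - 1 / 2)) (Set.uIcc 0 1) := by
      rw [Set.uIcc_of_le zero_le_one]
      exact (by fun_prop : ContinuousOn (fun x : ℝ => 1 + x) (Set.Icc 0 1)).rpow_const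
        fun x hx => Or.inl (by linarith [hx.1])
    refine (h1.mul_continuousOn hc).congr fun x hx => ?_
    rw [Set.uIoc_of_le zero_le_one] at hx
    rw [weight, ← Real.mul_rpow (by linarith [hx.2]) (by linarith [hx.1])]
    ring_nf
  have hl : IntervalIntegrable (weight lam) volume (-1) 0 := by
    have hc : ContinuousOn (fun x : ℝ => (1 - x) ^ (lam - 1 / 2)) (Set.uIcc (-1) 0) := by
      rw [Set.uIcc_of_le (by norm_num)]
      exact (by fun_prop : ContinuousOn (fun x : ℝ => 1 - x) (Set.Icc (-1) 0)).rpow_const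
        fun x hx => Or.inl (by linarith [hx.2])
    refine (h2.mul_continuousOn hc).congr fun x hx => ?_
    rw [Set.uIoc_of_le (by norm_num)] at hx
    rw [weight, ← Real.mul_rpow (by linarith [hx.1]) (by linarith [hx.2])]
    ring_nf
  exact hl.trans hr

theorem one_sub_sq_nonneg {t : ℝ} (ht : t ∈ Set.Icc (-1 : ℝ) 1) : 0 ≤ 1 - t ^ 2 := by
  nlinarith [ht.1, ht.2]

theorem one_sub_sq_pos {t : ℝ} (ht : t ∈ Set.Ioo (-1 : ℝ) 1) : 0 < 1 - t ^ 2 := by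
  nlinarith [ht.1, ht.2]

theorem weight_nonneg {t : ℝ} (ht : t ∈ Set.Icc (-1 : ℝ) 1) : 0 ≤ weight lam t :=
  Real.rpow_nonneg (one_sub_sq_nonneg ht) _

theorem measurable_weight : Measurable (weight lam) := by
  unfold weight
  fun_prop

theorem isFiniteMeasure_measure (hlam : -1 / 2 < lam) : IsFiniteMeasure (measure lam) := by
  have h := (intervalIntegrable_iff_integrableOn_Icc_of_le (by norm_num)).1
    (intervalIntegrable_weight hlam)
  exact isFiniteMeasure_withDensity_ofReal h.2

theorem ae_mem_Icc : ∀ᵐ t ∂(measure lam), t ∈ Set.Icc (-1 : ℝ) 1 :=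
  (withDensity_absolutelyContinuous _ _).ae_le (ae_restrict_mem measurableSet_Icc)

theorem integral_measure (F : ℝ → ℝ) :
    ∫ t, F t ∂(measure lam) = ∫ t in (-1)..1, weight lam t * F t := by
  rw [measure, integral_withDensity_eq_integral_toReal_smul
    (measurable_weight.ennreal_ofReal) (by simp), intervalIntegral.integral_of_le (by norm_num),
    ← integral_Icc_eq_integral_Ioc]
  refine setIntegral_congr_fun measurableSet_Icc fun t ht => ?_
  simp only [smul_eq_mul]
  rw [ENNReal.toReal_ofReal (weight_nonneg ht)]

theorem memLp_of_continuous {E : Type*} [NormedAddCommGroup E] [SecondCountableTopology E]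
    (hlam : -1 / 2 < lam) {F : ℝ → E} (hF : Continuous F) (p : ENNReal) :
    MemLp F p (measure lam) := by
  have := isFiniteMeasure_measure hlam
  obtain ⟨B, hB⟩ := isCompact_Icc.exists_bound_of_continuousOn
    (hF.continuousOn (s := Set.Icc (-1 : ℝ) 1))
  exact MemLp.of_bound hF.aestronglyMeasurable B (ae_mem_Icc.mono hB)

theorem integrable_of_continuous (hlam : -1 / 2 < lam) {F : ℝ → ℝ} (hF : Continuous F) :
    Integrable F (measure lam) :=
  memLp_one_iff_integrable.1 (memLp_of_continuous hlam hF 1)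

/-! ### Orthogonality of the Gegenbauer polynomials. -/

/-- Integration by parts: `D_λ` is symmetric on polynomials. -/
theorem integral_diffOp_symm (hlam : -1 / 2 < lam) (p q : ℝ[X]) :
    ∫ t, ((diffOp lam p).eval t * q.eval t - p.eval t * (diffOp lam q).eval t) ∂(measure lam)
      = 0 := by
  -- Lagrange identity: the integrand is the derivative of `(1-t²)^(λ+1/2) W`, which vanishes at
  -- both ends because `λ + 1/2 > 0`.
  set W : ℝ[X] := derivative p * q - p * derivative q with hW
  have hcont : ContinuousOn (fun t : ℝ => (1 - t ^ 2) ^ (lam + 1 / 2) * W.eval t)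
      (Set.Icc (-1) 1) :=
    ((by fun_prop : ContinuousOn (fun t : ℝ => 1 - t ^ 2) (Set.Icc (-1) 1)).rpow_const
      fun x hx => Or.inr (by linarith)).mul (W.continuous.continuousOn)
  have hderiv : ∀ t ∈ Set.Ioo (-1 : ℝ) 1,
      HasDerivAt (fun t : ℝ => (1 - t ^ 2) ^ (lam + 1 / 2) * W.eval t)
        (weight lam t * ((diffOp lam p).eval t * q.eval t - p.eval t * (diffOp lam q).eval t))
        t := by
    intro t ht
    have hpos := one_sub_sq_pos ht
    have h1 : HasDerivAt (fun t : ℝ => 1 - t ^ 2) (-(2 * t)) t := by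
      simpa using ((hasDerivAt_id t).pow 2).const_sub 1
    have h2 := (h1.rpow_const (p := lam + 1 / 2) (Or.inl hpos.ne')).mul (W.hasDerivAt t)
    refine h2.congr_deriv ?_
    rw [show lam + 1 / 2 - 1 = lam - 1 / 2 by ring,
      show (1 - t ^ 2) ^ (lam + 1 / 2) = (1 - t ^ 2) ^ (lam - 1 / 2) * (1 - t ^ 2) by
        rw [← Real.rpow_add_one hpos.ne']; ring_nf, weight]
    simp only [hW, diffOp, derivative_sub, derivative_mul, eval_sub, eval_mul, eval_add, eval_pow,
      eval_X, eval_C, eval_one]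
    ring
  have hcontF : Continuous fun t : ℝ =>
      ((diffOp lam p).eval t * q.eval t - p.eval t * (diffOp lam q).eval t) := by fun_prop
  rw [integral_measure, intervalIntegral.integral_eq_sub_of_hasDerivAt_of_le (by norm_num) hcont
    hderiv ((intervalIntegrable_weight hlam).mul_continuousOn hcontF.continuousOn)]
  have h0 : (0 : ℝ) ^ (lam + 1 / 2) = 0 := Real.zero_rpow (by linarith)
  norm_num [h0]

theorem eigenvalue_strictMono (hlam : -1 / 2 < lam) :
    StrictMono fun n : ℕ => (n : ℝ) * (n + 2 * lam) :=
  strictMono_nat_of_lt_succ fun n => by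
    have hn : (0 : ℝ) ≤ n := Nat.cast_nonneg n
    push_cast
    nlinarith

theorem integral_poly_mul_poly (hlam : -1 / 2 < lam) {m n : ℕ} (hmn : m ≠ n) :
    ∫ t, (poly lam m).eval t * (poly lam n).eval t ∂(measure lam) = 0 := by
  have h := integral_diffOp_symm hlam (poly lam m) (poly lam n)
  rw [diffOp_poly, diffOp_poly] at h
  have e : ∀ t : ℝ, (C (-((m : ℝ) * (m + 2 * lam))) * poly lam m).eval t * (poly lam n).eval t
      - (poly lam m).eval t * (C (-((n : ℝ) * (n + 2 * lam))) * poly lam n).eval t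
      = ((n : ℝ) * (n + 2 * lam) - (m : ℝ) * (m + 2 * lam)) *
        ((poly lam m).eval t * (poly lam n).eval t) := by
    intro t
    simp only [eval_mul, eval_C]
    ring
  simp only [e, integral_const_mul] at h
  refine (mul_eq_zero.1 h).resolve_left ?_
  rw [sub_eq_zero]
  exact fun h' => hmn ((eigenvalue_strictMono hlam).injective h').symm

/-- At `t = 1` the two derivative identities combine to `(n+1) C_{n+1}(1) = (n+2λ) C_n(1)`, whose
factors are nonzero. This shows that no `C_n^λ` degenerates to zero. -/
theorem poly_eval_one_ne_zero (hlam : -1 / 2 < lam) (n : ℕ) : (poly lam n).eval 1 ≠ 0 := by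
  unfold poly
  split_ifs with h0
  · simp
  · induction n with
    | zero => simp [recPoly]
    | succ n ih =>
      obtain ⟨hA, hB⟩ := recPoly_derivative lam n
      have hA' := congrArg (Polynomial.eval 1) hA
      have hB' := congrArg (Polynomial.eval 1) hB
      simp only [eval_sub, eval_mul, eval_add, eval_X, eval_C, eval_one, eval_natCast,
        one_mul, eval_ofNat] at hA' hB'
      have h : ((n : ℝ) + 1) * (recPoly lam (n + 1)).eval 1
          = (n + 2 * lam) * (recPoly lam n).eval 1 := by linarith
      have hne : (n : ℝ) + 2 * lam ≠ 0 := by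
        rcases Nat.eq_zero_or_pos n with rfl | hn
        · simpa using h0
        · have hn' : (1 : ℝ) ≤ n := by exact_mod_cast hn
          linarith
      intro h1
      rw [h1, mul_zero] at h
      exact mul_ne_zero hne ih h.symm

theorem integral_sq_eval_pos (hlam : -1 / 2 < lam) {p : ℝ[X]} (hp : p ≠ 0) :
    0 < ∫ t, p.eval t ^ 2 ∂(measure lam) := by
  have hnn : 0 ≤ ∫ t, p.eval t ^ 2 ∂(measure lam) := integral_nonneg fun t => sq_nonneg _
  refine hnn.lt_of_ne fun h => hp ?_
  have h1 := (integral_eq_zero_iff_of_nonneg (fun t => sq_nonneg _)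
    (integrable_of_continuous hlam (by fun_prop : Continuous fun t => p.eval t ^ 2))).1 h.symm
  -- The weight is positive inside the interval, so a polynomial vanishing almost everywhere for the
  -- measure vanishes Lebesgue-almost everywhere on it, against the finiteness of its root set.
  have hac : volume.restrict (Set.Ioo (-1 : ℝ) 1) ≪ measure lam := by
    rw [measure, ← Measure.restrict_congr_set Ioo_ae_eq_Icc]
    refine withDensity_absolutelyContinuous' measurable_weight.ennreal_ofReal.aemeasurable ?_
    filter_upwards [ae_restrict_mem measurableSet_Ioo] with t ht
    exact (ENNReal.ofReal_pos.2 (Real.rpow_pos_of_pos (one_sub_sq_pos ht) _)).ne'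
  have h2 := hac.ae_le h1
  by_contra hp0
  have hfin : {x | p.IsRoot x}.Finite := by
    by_contra hinf
    exact hp0 (eq_zero_of_infinite_isRoot p hinf)
  have h3 : ∀ᵐ t ∂(volume.restrict (Set.Ioo (-1 : ℝ) 1)), t ∉ {x | p.IsRoot x} :=
    ae_restrict_of_ae (measure_eq_zero_iff_ae_notMem.1 (hfin.measure_zero _))
  have h4 : ∀ᵐ t ∂(volume.restrict (Set.Ioo (-1 : ℝ) 1)), False := by
    filter_upwards [h2, h3] with t a b
    exact b (pow_eq_zero_iff two_ne_zero |>.1 a)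
  rw [ae_iff] at h4
  norm_num at h4

/-- The squared norm of `C_n^λ` in `L²(w_λ)`. -/
def rawNormSq (lam : ℝ) (n : ℕ) : ℝ := ∫ t, (poly lam n).eval t ^ 2 ∂(measure lam)

theorem poly_ne_zero (hlam : -1 / 2 < lam) (n : ℕ) : poly lam n ≠ 0 := by
  intro h
  apply poly_eval_one_ne_zero hlam n
  rw [h, eval_zero]

theorem rawNormSq_pos (hlam : -1 / 2 < lam) (n : ℕ) : 0 < rawNormSq lam n :=
  integral_sq_eval_pos hlam (poly_ne_zero hlam n)

theorem normConst_pos (hlam : -1 / 2 < lam) : 0 < normConst lam := by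
  have := integral_sq_eval_pos hlam (one_ne_zero (α := ℝ[X]))
  simp only [eval_one, one_pow] at this
  exact one_div_pos.2 this

/-! ### Three-term recurrence and orthonormalization. -/

open Classical in
/-- Coefficient of `C_{n+2}` in `t C_{n+1}`. -/
def recUp (lam : ℝ) (n : ℕ) : ℝ := if lam = 0 then 1 / 2 else (n + 2) / (2 * (n + 1 + lam))

open Classical in
/-- Coefficient of `C_n` in `t C_{n+1}`. -/
def recDown (lam : ℝ) (n : ℕ) : ℝ :=
  if lam = 0 then 1 / 2 else (n + 2 * lam) / (2 * (n + 1 + lam))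

theorem X_mul_poly (hlam : -1 / 2 < lam) (n : ℕ) :
    X * poly lam (n + 1) = C (recUp lam n) * poly lam (n + 2)
      + C (recDown lam n) * poly lam n := by
  unfold poly recUp recDown
  split_ifs with h0
  · have h := Polynomial.Chebyshev.T_add_two ℝ (n : ℤ)
    push_cast
    rw [h]
    have h2 : (C (1 / 2 : ℝ)) * 2 = 1 := by
      rw [show (2 : ℝ[X]) = C 2 from (map_ofNat C 2).symm, ← C_mul]; norm_num
    linear_combination (-(X * Chebyshev.T ℝ ((n : ℤ) + 1))) * h2
  · have h := recPoly_succ_succ lam n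
    have hn : (0 : ℝ) ≤ n := Nat.cast_nonneg n
    have hpos : 2 * ((n : ℝ) + 1 + lam) ≠ 0 := by
      have : 0 < (n : ℝ) + 1 + lam := by linarith
      positivity
    have e1 : C (((n : ℝ) + 2) / (2 * (n + 1 + lam)))
        = C (1 / (2 * ((n : ℝ) + 1 + lam))) * ((n : ℝ[X]) + 2) := by
      rw [show ((n : ℝ[X]) + 2) = C ((n : ℝ) + 2) by simp only [C_add, map_natCast, map_ofNat],
        ← C_mul]
      ring_nf
    have e2 : C (((n : ℝ) + 2 * lam) / (2 * (n + 1 + lam)))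
        = C (1 / (2 * ((n : ℝ) + 1 + lam))) * ((n : ℝ[X]) + 2 * C lam) := by
      rw [show ((n : ℝ[X]) + 2 * C lam) = C ((n : ℝ) + 2 * lam) by
        simp only [C_add, C_mul, map_natCast, map_ofNat], ← C_mul]
      ring_nf
    have e3 : C (1 / (2 * ((n : ℝ) + 1 + lam))) * (2 * ((n : ℝ[X]) + 1 + C lam)) = 1 := by
      rw [show (2 * ((n : ℝ[X]) + 1 + C lam)) = C (2 * ((n : ℝ) + 1 + lam)) by
        simp only [C_add, C_mul, C_1, map_natCast, map_ofNat], ← C_mul,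
        one_div_mul_cancel hpos, C_1]
    rw [e1, e2]
    linear_combination (-(X * recPoly lam (n + 1))) * e3
      - C (1 / (2 * ((n : ℝ) + 1 + lam))) * h

theorem recUp_mul_recDown (hlam : -1 / 2 < lam) (n : ℕ) :
    recUp lam n * recDown lam (n + 1) = jacobiSq lam (n + 1) / 4 := by
  have hn : (0 : ℝ) ≤ n := Nat.cast_nonneg n
  have h1 : (n : ℝ) + 1 + lam ≠ 0 := by linarith
  have h2 : (n : ℝ) + 1 + 1 + lam ≠ 0 := by linarith
  unfold recUp recDown jacobiSq
  push_cast
  split_ifs with h0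
  · subst h0
    field_simp
    ring
  · field_simp
    ring

theorem recUp_pos (hlam : -1 / 2 < lam) (n : ℕ) : 0 < recUp lam n := by
  have hn : (0 : ℝ) ≤ n := Nat.cast_nonneg n
  have h1 : 0 < (n : ℝ) + 1 + lam := by linarith
  unfold recUp
  split_ifs <;> positivity

/-- Both sides equal `∫ t C_{n+1} C_{n+2} w_λ`, with `t` absorbed by one factor or the other. This
gives the ratio of consecutive norms without computing either. -/
theorem recUp_mul_rawNormSq (hlam : -1 / 2 < lam) (n : ℕ) :
    recUp lam n * rawNormSq lam (n + 2) = recDown lam (n + 1) * rawNormSq lam (n + 1) := by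
  have hi : ∀ p q : ℝ[X], Integrable (fun t => p.eval t * q.eval t) (measure lam) := fun p q =>
    integrable_of_continuous hlam (by fun_prop)
  have h1 : ∫ t, (X * poly lam (n + 1)).eval t * (poly lam (n + 2)).eval t ∂(measure lam)
      = recUp lam n * rawNormSq lam (n + 2) := by
    rw [X_mul_poly hlam]
    simp only [eval_add, eval_mul, eval_C, add_mul, mul_assoc]
    rw [integral_add ((hi _ _).const_mul _) ((hi _ _).const_mul _), integral_const_mul,
      integral_const_mul, integral_poly_mul_poly hlam (show n ≠ n + 2 by omega), mul_zero, add_zero,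
      rawNormSq]
    simp only [sq]
  have h2 : ∫ t, (X * poly lam (n + 2)).eval t * (poly lam (n + 1)).eval t ∂(measure lam)
      = recDown lam (n + 1) * rawNormSq lam (n + 1) := by
    rw [X_mul_poly hlam]
    simp only [eval_add, eval_mul, eval_C, add_mul, mul_assoc]
    rw [integral_add ((hi _ _).const_mul _) ((hi _ _).const_mul _), integral_const_mul,
      integral_const_mul, integral_poly_mul_poly hlam (show n + 1 + 2 ≠ n + 1 by omega), mul_zero,
      zero_add, rawNormSq]
    simp only [sq]
  rw [← h1, ← h2]
  refine integral_congr_ae (Eventually.of_forall fun t => ?_)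
  simp only [eval_mul, eval_X]
  ring

/-- The orthonormal Gegenbauer polynomials. -/
def orthoPoly (lam : ℝ) (n : ℕ) : ℝ[X] := C (1 / √(rawNormSq lam n)) * poly lam n

theorem poly_eq_orthoPoly (hlam : -1 / 2 < lam) (n : ℕ) :
    poly lam n = C √(rawNormSq lam n) * orthoPoly lam n := by
  rw [orthoPoly, ← mul_assoc, ← C_mul,
    mul_one_div_cancel (Real.sqrt_pos.2 (rawNormSq_pos hlam n)).ne', C_1, one_mul]

theorem integral_orthoPoly (hlam : -1 / 2 < lam) (m n : ℕ) :
    ∫ t, (orthoPoly lam m).eval t * (orthoPoly lam n).eval t ∂(measure lam)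
      = if m = n then 1 else 0 := by
  have e : ∀ t, (orthoPoly lam m).eval t * (orthoPoly lam n).eval t
      = 1 / √(rawNormSq lam m) * (1 / √(rawNormSq lam n)) *
        ((poly lam m).eval t * (poly lam n).eval t) := by
    intro t
    simp only [orthoPoly, eval_mul, eval_C]
    ring
  simp only [e, integral_const_mul]
  split_ifs with h
  · subst h
    have hp := rawNormSq_pos hlam m
    have : ∫ t, (poly lam m).eval t * (poly lam m).eval t ∂(measure lam) = rawNormSq lam m := by
      rw [rawNormSq]; simp only [sq]
    rw [this, div_mul_div_comm, Real.mul_self_sqrt hp.le, mul_one, one_div_mul_cancel hp.ne']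
  · rw [integral_poly_mul_poly hlam h, mul_zero]

theorem recUp_mul_sqrt_div (hlam : -1 / 2 < lam) (n : ℕ) :
    recUp lam n * √(rawNormSq lam (n + 2)) / √(rawNormSq lam (n + 1))
      = √(jacobiSq lam (n + 1)) / 2 := by
  have h1 := rawNormSq_pos hlam (n + 1)
  have h2 := rawNormSq_pos hlam (n + 2)
  have hu := recUp_pos hlam n
  have e := recUp_mul_rawNormSq hlam n
  have e2 := recUp_mul_recDown hlam n
  have hJ : jacobiSq lam (n + 1) = (2 * (recUp lam n * √(rawNormSq lam (n + 2))
      / √(rawNormSq lam (n + 1)))) ^ 2 := by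
    rw [mul_pow, div_pow, mul_pow, Real.sq_sqrt h1.le, Real.sq_sqrt h2.le]
    field_simp
    linear_combination (-4 * rawNormSq lam (n + 1)) * e2 - 4 * recUp lam n * e
  rw [hJ, Real.sqrt_sq (by positivity)]
  ring

theorem recDown_mul_sqrt_div (hlam : -1 / 2 < lam) (n : ℕ) :
    recDown lam (n + 1) * √(rawNormSq lam (n + 1)) / √(rawNormSq lam (n + 2))
      = √(jacobiSq lam (n + 1)) / 2 := by
  rw [← recUp_mul_sqrt_div hlam]
  have h1 := rawNormSq_pos hlam (n + 1)
  have h2 := rawNormSq_pos hlam (n + 2)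
  have e := recUp_mul_rawNormSq hlam n
  rw [← Real.sq_sqrt h1.le, ← Real.sq_sqrt h2.le] at e
  have s1 := Real.sqrt_pos.2 h1
  have s2 := Real.sqrt_pos.2 h2
  rw [div_eq_div_iff s2.ne' s1.ne']
  linarith

/-- The lower coefficient is left unsimplified so that `n = 0` is covered. For `λ = 0` the formula
`√(jacobiSq 0)/2` would fail there, as `jacobiSq 0 0` is `0/0 = 0`. -/
theorem X_mul_orthoPoly_aux (hlam : -1 / 2 < lam) (n : ℕ) :
    X * orthoPoly lam (n + 1) =
      C (√(jacobiSq lam (n + 1)) / 2) * orthoPoly lam (n + 2)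
      + C (recDown lam n * √(rawNormSq lam n) / √(rawNormSq lam (n + 1))) * orthoPoly lam n := by
  rw [← recUp_mul_sqrt_div hlam]
  have h := X_mul_poly hlam n
  rw [poly_eq_orthoPoly hlam (n + 2), poly_eq_orthoPoly hlam n] at h
  conv_lhs => rw [orthoPoly]
  rw [mul_left_comm, h, mul_add, ← mul_assoc, ← mul_assoc, ← mul_assoc, ← mul_assoc, ← C_mul,
    ← C_mul, ← C_mul, ← C_mul]
  congr 3 <;> ring

/-- Three-term recurrence of the orthonormal polynomials. -/
theorem X_mul_orthoPoly (hlam : -1 / 2 < lam) (n : ℕ) :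
    X * orthoPoly lam (n + 2) =
      C (√(jacobiSq lam (n + 2)) / 2) * orthoPoly lam (n + 3)
      + C (√(jacobiSq lam (n + 1)) / 2) * orthoPoly lam (n + 1) := by
  rw [X_mul_orthoPoly_aux hlam (n + 1), recDown_mul_sqrt_div hlam]

theorem poly_zero : poly lam 0 = 1 := by
  unfold poly
  split_ifs <;> simp [recPoly]

theorem exists_X_mul_poly_zero : ∃ b : ℝ, X * poly lam 0 = C b * poly lam 1 := by
  rw [poly_zero]
  unfold poly
  split_ifs with h0
  · exact ⟨1, by simp⟩
  · refine ⟨1 / (2 * lam), ?_⟩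
    rw [recPoly, ← mul_assoc, ← C_mul, one_div_mul_cancel (by simpa using h0)]
    simp

/-- The span contains 1 and, by the recurrence, is stable under multiplication by `X`. -/
theorem mem_span_orthoPoly (hlam : -1 / 2 < lam) (p : ℝ[X]) :
    p ∈ Submodule.span ℝ (Set.range (orthoPoly lam)) := by
  set S := Submodule.span ℝ (Set.range (orthoPoly lam)) with hS
  have hpoly : ∀ n, poly lam n ∈ S := by
    intro n
    rw [poly_eq_orthoPoly hlam, ← smul_eq_C_mul]
    exact S.smul_mem _ (Submodule.subset_span ⟨n, rfl⟩)
  have hXpoly : ∀ n, X * poly lam n ∈ S := by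
    rintro (_ | n)
    · obtain ⟨b, hb⟩ := exists_X_mul_poly_zero (lam := lam)
      rw [hb, ← smul_eq_C_mul]
      exact S.smul_mem _ (hpoly 1)
    · rw [X_mul_poly hlam, ← smul_eq_C_mul, ← smul_eq_C_mul]
      exact S.add_mem (S.smul_mem _ (hpoly _)) (S.smul_mem _ (hpoly _))
  have hX : ∀ q ∈ S, X * q ∈ S := by
    intro q hq
    induction hq using Submodule.span_induction with
    | mem x hx =>
      obtain ⟨n, rfl⟩ := hx
      rw [orthoPoly, mul_left_comm, ← smul_eq_C_mul]
      exact S.smul_mem _ (hXpoly n)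
    | zero => simp
    | add x y _ _ hx hy => rw [mul_add]; exact S.add_mem hx hy
    | smul a x _ hx => rw [mul_smul_comm]; exact S.smul_mem _ hx
  have hpow : ∀ n : ℕ, (X : ℝ[X]) ^ n ∈ S := by
    intro n
    induction n with
    | zero => rw [pow_zero, ← poly_zero (lam := lam)]; exact hpoly 0
    | succ n ih => rw [pow_succ']; exact hX _ ih
  rw [p.as_sum_range_C_mul_X_pow]
  refine S.sum_mem fun i _ => ?_
  rw [← smul_eq_C_mul]
  exact S.smul_mem _ (hpow i)

/-! ### Completeness and Parseval's identity. -/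

variable {𝕜 : Type*} [RCLike 𝕜]

/-- The coefficient of `f` with respect to the orthonormal Gegenbauer polynomials. -/
def orthoCoeff (lam : ℝ) (f : ℝ → 𝕜) (n : ℕ) : 𝕜 :=
  ∫ t, ((orthoPoly lam n).eval t) • f t ∂(measure lam)

/-- The two normalizations differ by a factor independent of `n`, so coefficient relations may be
checked on `orthoCoeff`. -/
theorem coeff_eq (hlam : -1 / 2 < lam) (f : ℝ → 𝕜) (n : ℕ) :
    coeff lam f n = √(normConst lam) • orthoCoeff lam f n := by
  have hc := normConst_pos hlam
  have hN := rawNormSq_pos hlam n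
  have e : ∀ t, (orthoPoly lam n).eval t • f t
      = (1 / √(rawNormSq lam n)) • ((poly lam n).eval t • f t) := by
    intro t
    rw [orthoPoly, eval_mul, eval_C, mul_smul]
  rw [coeff, orthoCoeff]
  simp only [e, integral_smul]
  rw [smul_smul, normSq, ← rawNormSq, Real.sqrt_mul hc.le]
  congr 1
  have s1 := Real.sqrt_pos.2 hc
  have s2 := Real.sqrt_pos.2 hN
  field_simp
  exact (Real.sq_sqrt hc.le).symm

theorem memLp_orthoPoly (hlam : -1 / 2 < lam) (n : ℕ) :
    MemLp (fun t => (((orthoPoly lam n).eval t : ℝ) : 𝕜)) 2 (measure lam) :=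
  memLp_of_continuous hlam (RCLike.continuous_ofReal.comp (orthoPoly lam n).continuous) 2

/-- The orthonormal Gegenbauer polynomials as elements of `L²(w_λ)`. -/
def orthoLp (𝕜 : Type*) [RCLike 𝕜] (hlam : -1 / 2 < lam) (n : ℕ) : Lp 𝕜 2 (measure lam) :=
  (memLp_orthoPoly hlam n).toLp _

theorem inner_orthoLp (hlam : -1 / 2 < lam) (n : ℕ) {f : ℝ → 𝕜} (x : Lp 𝕜 2 (measure lam))
    (hx : x =ᵐ[measure lam] f) :
    inner 𝕜 (orthoLp 𝕜 hlam n) x = orthoCoeff lam f n := by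
  rw [L2.inner_def, orthoCoeff]
  refine integral_congr_ae ?_
  filter_upwards [hx, (memLp_orthoPoly (𝕜 := 𝕜) hlam n).coeFn_toLp] with t h1 h2
  rw [orthoLp, h1, h2, RCLike.inner_apply, RCLike.conj_ofReal, RCLike.real_smul_eq_coe_mul,
    mul_comm]

theorem orthoCoeff_orthoPoly (hlam : -1 / 2 < lam) (m n : ℕ) :
    orthoCoeff lam (fun t => (((orthoPoly lam m).eval t : ℝ) : 𝕜)) n = if n = m then 1 else 0 := by
  have e : ∀ t, (orthoPoly lam n).eval t • (((orthoPoly lam m).eval t : ℝ) : 𝕜)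
      = (((orthoPoly lam n).eval t * (orthoPoly lam m).eval t : ℝ) : 𝕜) := by
    intro t
    rw [RCLike.real_smul_eq_coe_mul, RCLike.ofReal_mul]
  rw [orthoCoeff]
  simp only [e]
  rw [integral_ofReal, integral_orthoPoly hlam]
  split_ifs <;> simp

theorem orthonormal_orthoLp (hlam : -1 / 2 < lam) : Orthonormal 𝕜 (orthoLp 𝕜 hlam) := by
  rw [orthonormal_iff_ite]
  intro m n
  exact (inner_orthoLp hlam m _ (memLp_orthoPoly (𝕜 := 𝕜) hlam n).coeFn_toLp).trans
    (orthoCoeff_orthoPoly hlam n m)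

theorem integrable_continuous_smul (hlam : -1 / 2 < lam) {f : ℝ → 𝕜}
    (hf : MemLp f 2 (measure lam)) {F : ℝ → ℝ} (hF : Continuous F) :
    Integrable (fun t => F t • f t) (measure lam) := by
  have := isFiniteMeasure_measure hlam
  have hfi : Integrable f (measure lam) := hf.integrable (by norm_num)
  obtain ⟨B, hB⟩ := isCompact_Icc.exists_bound_of_continuousOn
    (hF.continuousOn (s := Set.Icc (-1 : ℝ) 1))
  refine (hfi.norm.const_mul B).mono' (hF.aestronglyMeasurable.smul hfi.1) ?_
  filter_upwards [ae_mem_Icc] with t ht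
  rw [norm_smul]
  exact mul_le_mul_of_nonneg_right (hB t ht) (norm_nonneg _)

/-- Such an `f` annihilates all polynomials, hence by Weierstrass approximation on `[-1, 1]` all
smooth test functions. -/
theorem ae_eq_zero_of_orthoCoeff_eq_zero (hlam : -1 / 2 < lam) {f : ℝ → 𝕜}
    (hf : MemLp f 2 (measure lam)) (h : ∀ n, orthoCoeff lam f n = 0) :
    ∀ᵐ t ∂(measure lam), f t = 0 := by
  have := isFiniteMeasure_measure hlam
  have hfi : Integrable f (measure lam) := hf.integrable (by norm_num)
  have hint : ∀ {F : ℝ → ℝ}, Continuous F → Integrable (fun t => F t • f t) (measure lam) :=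
    fun hF => integrable_continuous_smul hlam hf hF
  have hpoly : ∀ p : ℝ[X], ∫ t, p.eval t • f t ∂(measure lam) = 0 := by
    intro p
    have hp := mem_span_orthoPoly hlam p
    induction hp using Submodule.span_induction with
    | mem x hx => obtain ⟨n, rfl⟩ := hx; exact h n
    | zero => simp
    | add x y _ _ hx hy =>
      simp only [eval_add, add_smul]
      rw [integral_add (hint x.continuous) (hint y.continuous), hx, hy, add_zero]
    | smul a x _ hx =>
      simp only [eval_smul, smul_assoc]
      rw [integral_smul, hx, smul_zero]
  refine ae_eq_zero_of_integral_contDiff_smul_eq_zero hfi.locallyIntegrable fun g hg _ => ?_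
  have hgc := hg.continuous
  rw [← norm_le_zero_iff]
  refine le_of_forall_pos_le_add fun ε hε => ?_
  set A := ∫ t, ‖f t‖ ∂(measure lam) with hA
  have hA0 : 0 ≤ A := integral_nonneg fun t => norm_nonneg _
  obtain ⟨p, hp⟩ := exists_polynomial_near_of_continuousOn (-1) 1 g hgc.continuousOn
    (ε / (A + 1)) (by positivity)
  have e : ∫ t, g t • f t ∂(measure lam) = ∫ t, (g t - p.eval t) • f t ∂(measure lam) := by
    simp only [sub_smul]
    rw [integral_sub (hint hgc) (hint p.continuous), hpoly, sub_zero]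
  rw [e]
  calc ‖∫ t, (g t - p.eval t) • f t ∂(measure lam)‖
      ≤ ∫ t, ‖(g t - p.eval t) • f t‖ ∂(measure lam) := norm_integral_le_integral_norm _
    _ ≤ ∫ t, ε / (A + 1) * ‖f t‖ ∂(measure lam) := by
        refine integral_mono_ae (hint (hgc.sub p.continuous)).norm (hfi.norm.const_mul _) ?_
        filter_upwards [ae_mem_Icc] with t ht
        rw [norm_smul]
        refine mul_le_mul_of_nonneg_right ?_ (norm_nonneg _)
        rw [Real.norm_eq_abs, abs_sub_comm]
        exact (hp t ht).le
    _ = ε / (A + 1) * A := by rw [integral_const_mul]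
    _ ≤ 0 + ε := by
        rw [zero_add, div_mul_eq_mul_div, div_le_iff₀ (by positivity)]
        nlinarith

/-- The Hilbert basis of `L²(w_λ)` consisting of the orthonormal Gegenbauer polynomials. -/
def orthoBasis (𝕜 : Type*) [RCLike 𝕜] (hlam : -1 / 2 < lam) :
    HilbertBasis ℕ 𝕜 (Lp 𝕜 2 (measure lam)) :=
  HilbertBasis.mkOfOrthogonalEqBot (orthonormal_orthoLp hlam) (by
    rw [Submodule.eq_bot_iff]
    intro x hx
    rw [Submodule.mem_orthogonal] at hx
    refine (Lp.eq_zero_iff_ae_eq_zero).2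
      (ae_eq_zero_of_orthoCoeff_eq_zero hlam (Lp.memLp x) fun n => ?_)
    rw [← inner_orthoLp hlam n x (ae_eq_refl _)]
    exact hx _ (Submodule.subset_span ⟨n, rfl⟩))

/-- Parseval's identity for Gegenbauer expansions. -/
theorem hasSum_orthoCoeff (hlam : -1 / 2 < lam) {f g : ℝ → 𝕜}
    (hf : MemLp f 2 (measure lam)) (hg : MemLp g 2 (measure lam)) :
    HasSum (fun n => star (orthoCoeff lam f n) * orthoCoeff lam g n)
      (∫ t, star (f t) * g t ∂(measure lam)) := by
  have h := (orthoBasis 𝕜 hlam).hasSum_inner_mul_inner (hf.toLp f) (hg.toLp g)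
  have e : inner 𝕜 (hf.toLp f) (hg.toLp g) = ∫ t, star (f t) * g t ∂(measure lam) := by
    rw [L2.inner_def]
    refine integral_congr_ae ?_
    filter_upwards [hf.coeFn_toLp, hg.coeFn_toLp] with t h1 h2
    rw [h1, h2, RCLike.inner_apply, mul_comm]
    rfl
  rw [e] at h
  refine h.congr_fun fun n => ?_
  rw [← inner_conj_symm (hf.toLp f), orthoBasis, HilbertBasis.coe_mkOfOrthogonalEqBot,
    inner_orthoLp hlam n _ hf.coeFn_toLp, inner_orthoLp hlam n _ hg.coeFn_toLp]
  rfl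

theorem hasSum_norm_sq_orthoCoeff (hlam : -1 / 2 < lam) {f : ℝ → 𝕜}
    (hf : MemLp f 2 (measure lam)) :
    HasSum (fun n => ‖orthoCoeff lam f n‖ ^ 2) (∫ t, ‖f t‖ ^ 2 ∂(measure lam)) := by
  have h := hasSum_orthoCoeff hlam hf hf
  have e : ∀ z : 𝕜, star z * z = ((‖z‖ ^ 2 : ℝ) : 𝕜) := fun z => by
    rw [RCLike.ofReal_pow]; exact RCLike.conj_mul z
  simp only [e] at h
  rw [integral_ofReal] at h
  exact (RCLike.hasSum_ofReal 𝕜).1 h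

/-! ### Multiplication by `t` in coefficients. -/

theorem memLp_mul_id {g : ℝ → 𝕜} (hg : MemLp g 2 (measure lam)) :
    MemLp (fun t : ℝ => t • g t) 2 (measure lam) := by
  refine hg.of_le (aestronglyMeasurable_id.smul hg.1) ?_
  filter_upwards [ae_mem_Icc] with t ht
  rw [norm_smul, Real.norm_eq_abs]
  exact mul_le_of_le_one_left (norm_nonneg _) (abs_le.2 ht)

theorem orthoCoeff_mul_id (hlam : -1 / 2 < lam) {g : ℝ → 𝕜} (hg : MemLp g 2 (measure lam))
    {k l m : ℕ} {a b : ℝ} (h : X * orthoPoly lam k = C a * orthoPoly lam l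
      + C b * orthoPoly lam m) :
    orthoCoeff lam (fun t : ℝ => t • g t) k
      = a • orthoCoeff lam g l + b • orthoCoeff lam g m := by
  have e : ∀ t : ℝ, (orthoPoly lam k).eval t • (t • g t)
      = a • ((orthoPoly lam l).eval t • g t) + b • ((orthoPoly lam m).eval t • g t) := by
    intro t
    have := congrArg (Polynomial.eval t) h
    simp only [eval_mul, eval_X, eval_add, eval_C] at this
    rw [smul_smul, smul_smul, smul_smul, ← add_smul, ← this, mul_comm]
  simp only [orthoCoeff, e]
  have hi : ∀ (n : ℕ) (x : ℝ), Integrable (fun t => x • ((orthoPoly lam n).eval t • g t))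
      (measure lam) := fun n x =>
    (integrable_continuous_smul hlam hg (orthoPoly lam n).continuous).smul x
  rw [integral_add (hi l a) (hi m b), integral_smul, integral_smul]

theorem bddAbove_alpha (hlam : -1 / 2 < lam) : ∃ B, ∀ n, alpha lam n ^ 2 ≤ B := by
  obtain ⟨B, hB⟩ := (tendsto_alpha_sq hlam).bddAbove_range
  exact ⟨B, fun n => hB ⟨n, rfl⟩⟩

/-- The quadratic form of multiplication by `t` in Gegenbauer coefficients. -/
theorem hasSum_jacobi (hlam : -1 / 2 < lam) {g : ℝ → 𝕜} (hg : MemLp g 2 (measure lam))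
    (h0 : orthoCoeff lam g 0 = 0) :
    HasSum (fun k => √(jacobiSq lam (k + 1)) *
        RCLike.re (star (orthoCoeff lam g (k + 1)) * orthoCoeff lam g (k + 2)))
      (∫ t, t * ‖g t‖ ^ 2 ∂(measure lam)) := by
  set G : ℕ → 𝕜 := fun n => orthoCoeff lam g n with hG
  set r : ℕ → ℝ := fun k => √(jacobiSq lam (k + 1)) * RCLike.re (star (G (k + 1)) * G (k + 2))
    with hr
  have hsq := (hasSum_norm_sq_orthoCoeff hlam hg).summable
  have hrsum : Summable r := by
    obtain ⟨B, hB⟩ := bddAbove_alpha hlam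
    have hd : Summable fun k => (alpha lam (k + 1) * ‖G (k + 1)‖) ^ 2 := by
      refine (((summable_nat_add_iff 1).2 hsq).mul_left B).of_nonneg_of_le
        (fun k => sq_nonneg _) fun k => ?_
      rw [mul_pow]
      exact mul_le_mul_of_nonneg_right (hB _) (sq_nonneg _)
    refine (tsum_mul_succ_le_hardy hd).1.of_norm_bounded fun k => ?_
    rw [hr, Real.norm_eq_abs, abs_mul, abs_of_nonneg (Real.sqrt_nonneg _),
      ← alpha_mul_succ hlam (show 1 ≤ k + 1 by omega)]
    have h1 := RCLike.abs_re_le_norm (star (G (k + 1)) * G (k + 2))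
    rw [norm_mul, norm_star] at h1
    calc _ ≤ alpha lam (k + 1) * alpha lam (k + 1 + 1) * (‖G (k + 1)‖ * ‖G (k + 2)‖) :=
          mul_le_mul_of_nonneg_left h1 (mul_nonneg (alpha_pos hlam (by omega)).le
            (alpha_pos hlam (by omega)).le)
      _ = _ := by ring
  have hpars := hasSum_orthoCoeff hlam hg (memLp_mul_id hg)
  have e1 : ∀ t, star (g t) * (t • g t) = ((t * ‖g t‖ ^ 2 : ℝ) : 𝕜) := by
    intro t
    rw [mul_smul_comm, RCLike.real_smul_eq_coe_mul, RCLike.ofReal_mul, RCLike.ofReal_pow]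
    congr 1
    exact RCLike.conj_mul _
  simp only [e1] at hpars
  rw [integral_ofReal] at hpars
  have hre := hpars.mapL (RCLike.reCLM (K := 𝕜))
  simp only [RCLike.reCLM_apply, RCLike.ofReal_re] at hre
  rw [← hasSum_nat_add_iff' 1] at hre
  have hz : orthoCoeff lam g 0 = 0 := h0
  simp only [Finset.sum_range_one, hz, star_zero, zero_mul, map_zero, sub_zero] at hre
  -- Each product of neighbouring coefficients occurs in two rows of the matrix, with weight one
  -- half in each. `r'` is `r` shifted by one place; its entry 0 reflects `g_0 = 0`.
  set r' : ℕ → ℝ := fun k => Nat.casesOn k 0 r with hr'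
  have hr'sum : HasSum r' (∑' k, r k) := by
    rw [← hasSum_nat_add_iff' 1]
    simpa [hr'] using hrsum.hasSum
  have hhalf := (hrsum.hasSum.add hr'sum).mul_right (1 / 2)
  have hterm : ∀ k, RCLike.re (star (orthoCoeff lam g (k + 1)) *
      orthoCoeff lam (fun t : ℝ => t • g t) (k + 1)) = (r k + r' k) * (1 / 2) := by
    rintro (_ | k)
    · rw [orthoCoeff_mul_id hlam hg (X_mul_orthoPoly_aux hlam 0), hz, smul_zero, add_zero,
        mul_smul_comm, RCLike.smul_re]
      rw [show r' 0 = 0 from rfl, add_zero]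
      simp only [hr, hG]
      ring
    · rw [orthoCoeff_mul_id hlam hg (X_mul_orthoPoly hlam k), mul_add, map_add,
        mul_smul_comm, RCLike.smul_re, mul_smul_comm, RCLike.smul_re]
      have hsym : RCLike.re (star (orthoCoeff lam g (k + 1 + 1)) * orthoCoeff lam g (k + 1))
          = RCLike.re (star (orthoCoeff lam g (k + 1)) * orthoCoeff lam g (k + 1 + 1)) := by
        rw [← RCLike.conj_re, map_mul]
        congr 1
        rw [mul_comm]
        congr 1
        exact star_star _
      rw [show k + 2 = k + 1 + 1 from rfl, hsym]
      simp only [hr, hr', hG]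
      ring
  simp only [hterm] at hre
  have := hre.unique hhalf
  rw [this, show (∑' k, r k + ∑' k, r k) * (1 / 2) = ∑' k, r k by ring]
  exact hrsum.hasSum

/-! ### Finite expansions and the lower bound for the constant. -/

/-- The finite Gegenbauer expansion with orthonormal coefficients `a n`, `n < R`. -/
def finiteExpansion (𝕜 : Type*) [RCLike 𝕜] (lam : ℝ) (a : ℕ → ℝ) (R : ℕ) (t : ℝ) : 𝕜 :=
  (((∑ n ∈ Finset.range R, C (a n) * orthoPoly lam n).eval t : ℝ) : 𝕜)

theorem memLp_finiteExpansion (hlam : -1 / 2 < lam) (a : ℕ → ℝ) (R : ℕ) :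
    MemLp (finiteExpansion 𝕜 lam a R) 2 (measure lam) :=
  memLp_of_continuous hlam (RCLike.continuous_ofReal.comp (Polynomial.continuous _)) 2

theorem orthoCoeff_finiteExpansion (hlam : -1 / 2 < lam) {a : ℕ → ℝ} {R : ℕ}
    (ha : ∀ n, R ≤ n → a n = 0) (n : ℕ) :
    orthoCoeff lam (finiteExpansion 𝕜 lam a R) n = (a n : 𝕜) := by
  have e : ∀ t, (orthoPoly lam n).eval t • finiteExpansion 𝕜 lam a R t
      = ((∑ m ∈ Finset.range R, a m * ((orthoPoly lam n).eval t * (orthoPoly lam m).eval t) : ℝ)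
        : 𝕜) := by
    intro t
    rw [finiteExpansion, RCLike.real_smul_eq_coe_mul, ← RCLike.ofReal_mul, eval_finsetSum,
      Finset.mul_sum]
    congr 1
    refine Finset.sum_congr rfl fun m _ => ?_
    rw [eval_mul, eval_C]
    ring
  simp only [orthoCoeff, e]
  rw [integral_ofReal, integral_finsetSum _ fun m _ =>
    (integrable_of_continuous hlam (by fun_prop)).const_mul _]
  simp only [integral_const_mul, integral_orthoPoly hlam, mul_ite, mul_one, mul_zero,
    Finset.sum_ite_eq, Finset.mem_range]
  split_ifs with h
  · rfl
  · rw [ha n (not_lt.1 h)]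

theorem integral_norm_sq_finiteExpansion (hlam : -1 / 2 < lam) {a : ℕ → ℝ} {R : ℕ}
    (ha : ∀ n, R ≤ n → a n = 0) :
    ∫ t, ‖finiteExpansion 𝕜 lam a R t‖ ^ 2 ∂(measure lam) = ∑ n ∈ Finset.range R, a n ^ 2 := by
  have h := hasSum_norm_sq_orthoCoeff hlam (memLp_finiteExpansion (𝕜 := 𝕜) hlam a R)
  simp only [orthoCoeff_finiteExpansion hlam ha, RCLike.norm_ofReal, sq_abs] at h
  refine h.unique (hasSum_sum_of_ne_finset_zero fun n hn => ?_)
  rw [ha n (by simpa using hn)]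
  simp

theorem integral_mul_norm_sq_finiteExpansion (hlam : -1 / 2 < lam) {a : ℕ → ℝ} {R : ℕ}
    (ha0 : a 0 = 0) (ha : ∀ n, R ≤ n → a n = 0) :
    ∫ t, t * ‖finiteExpansion 𝕜 lam a R t‖ ^ 2 ∂(measure lam)
      = ∑ n ∈ Finset.range R, √(jacobiSq lam n) * (a n * a (n + 1)) := by
  have h := hasSum_jacobi hlam (memLp_finiteExpansion (𝕜 := 𝕜) hlam a R)
    (by rw [orthoCoeff_finiteExpansion hlam ha, ha0, RCLike.ofReal_zero])
  have e : ∀ x y : ℝ, RCLike.re (star (x : 𝕜) * (y : 𝕜)) = x * y := by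
    intro x y
    rw [show star (x : 𝕜) = (x : 𝕜) from RCLike.conj_ofReal x, ← RCLike.ofReal_mul,
      RCLike.ofReal_re]
  simp only [orthoCoeff_finiteExpansion hlam ha, e] at h
  have h2 : HasSum (fun n => √(jacobiSq lam n) * (a n * a (n + 1)))
      (∑ n ∈ Finset.range R, √(jacobiSq lam n) * (a n * a (n + 1))) :=
    hasSum_sum_of_ne_finset_zero fun n hn => by
      rw [ha n (by simpa using hn)]
      simp
  rw [← hasSum_nat_add_iff' 1] at h2
  simp only [Finset.sum_range_one, ha0, zero_mul, mul_zero, sub_zero] at h2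
  exact h.unique h2

theorem integral_one_sub_mul_norm_sq {g : ℝ → 𝕜}
    (hg : MemLp g 2 (measure lam)) :
    ∫ t, (1 - t) * ‖g t‖ ^ 2 ∂(measure lam)
      = ∫ t, ‖g t‖ ^ 2 ∂(measure lam) - ∫ t, t * ‖g t‖ ^ 2 ∂(measure lam) := by
  have h1 : Integrable (fun t => ‖g t‖ ^ 2) (measure lam) :=
    (memLp_two_iff_integrable_sq_norm hg.1).1 hg
  have h2 : Integrable (fun t => t * ‖g t‖ ^ 2) (measure lam) := by
    refine h1.mono' (aestronglyMeasurable_id.mul h1.1) ?_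
    filter_upwards [ae_mem_Icc] with t ht
    rw [norm_mul, Real.norm_eq_abs, Real.norm_eq_abs, abs_of_nonneg (sq_nonneg ‖g t‖)]
    exact mul_le_of_le_one_left (sq_nonneg _) (abs_le.2 ht)
  rw [← integral_sub h1 h2]
  simp only [sub_mul, one_mul]

theorem coeff_eq_smul_iff (hlam : -1 / 2 < lam) {f g : ℝ → 𝕜} {n : ℕ} {x : ℝ} :
    coeff lam g n = x • coeff lam f n ↔ orthoCoeff lam g n = x • orthoCoeff lam f n := by
  have hc := (Real.sqrt_pos.2 (normConst_pos hlam)).ne'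
  rw [coeff_eq hlam, coeff_eq hlam, smul_comm x]
  exact (smul_right_injective 𝕜 hc).eq_iff

theorem coeff_eq_zero_iff (hlam : -1 / 2 < lam) {f : ℝ → 𝕜} {n : ℕ} :
    coeff lam f n = 0 ↔ orthoCoeff lam f n = 0 := by
  have hc := (Real.sqrt_pos.2 (normConst_pos hlam)).ne'
  rw [coeff_eq hlam, smul_eq_zero]
  simp [hc]

theorem isFracPow_finiteExpansion (hlam : -1 / 2 < lam) {s : ℝ} {a b : ℕ → ℝ} {R : ℕ}
    (ha : ∀ n, R ≤ n → a n = 0) (hb : ∀ n, R ≤ n → b n = 0)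
    (hab : ∀ n : ℕ, b n = ((n : ℝ) * (n + 2 * lam)) ^ s * a n) :
    IsFracPow lam s (finiteExpansion 𝕜 lam a R) (finiteExpansion 𝕜 lam b R) where
  memLp_left := memLp_finiteExpansion hlam a R
  memLp_right := memLp_finiteExpansion hlam b R
  coeff_eq n := by
    rw [coeff_eq_smul_iff hlam, orthoCoeff_finiteExpansion hlam ha,
      orthoCoeff_finiteExpansion hlam hb, hab, RCLike.real_smul_eq_coe_mul, RCLike.ofReal_mul]

theorem eigenvalue_pos (hlam : -1 / 2 < lam) {n : ℕ} (hn : 1 ≤ n) :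
    0 < (n : ℝ) * (n + 2 * lam) := by
  have hn' : (1 : ℝ) ≤ n := by exact_mod_cast hn
  exact mul_pos (by linarith) (by linarith)

/-- Lower bound for the constant in the Hardy–Rellich inequality. -/
theorem HardyRellich.one_le (hlam : -1 / 2 < lam) {s : ℝ} {n₀ : ℕ} {c : ℝ}
    (H : HardyRellich 𝕜 lam s n₀ c) {ε : ℝ} (hε : 0 < ε) :
    0 ≤ c ∧ 1 ≤ c * (betaInf lam + ε) := by
  obtain ⟨a, R, ha0, haR, hS, hle⟩ := exists_jacobi_near_extremal hlam hε n₀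
  -- The near-extremal `a` are the coefficients of `(-D_λ)^{1/2} f`. At `n = 0` both `a` and the
  -- eigenvalue vanish, and `f 0 = 0`.
  set f : ℕ → ℝ := fun n => a n / √((n : ℝ) * (n + 2 * lam)) with hf
  have hfR : ∀ n, R ≤ n → f n = 0 := fun n hn => by simp [hf, haR n hn]
  have hfa : ∀ n : ℕ, a n = ((n : ℝ) * (n + 2 * lam)) ^ (1 / 2 : ℝ) * f n := by
    intro n
    rcases Nat.eq_zero_or_pos n with rfl | hn
    · simp [ha0 0 (Nat.zero_le _), hf]
    · rw [← Real.sqrt_eq_rpow, hf,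
        mul_div_cancel₀ _ (Real.sqrt_pos.2 (eigenvalue_pos hlam hn)).ne']
  have hineq := H _ _ (isFracPow_finiteExpansion (𝕜 := 𝕜) hlam hfR haR hfa)
    ⟨_, isFracPow_finiteExpansion (𝕜 := 𝕜) hlam hfR
      (b := fun n => ((n : ℝ) * (n + 2 * lam)) ^ s * f n)
      (fun n hn => by rw [hfR n hn, mul_zero]) fun n => rfl⟩
    (fun j hj => by
      rw [coeff_eq_zero_iff hlam, orthoCoeff_finiteExpansion hlam hfR]
      simp [hf, ha0 j hj])
  have hQ0 : 0 ≤ ∫ t, (1 - t) * ‖finiteExpansion 𝕜 lam a R t‖ ^ 2 ∂(measure lam) := by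
    refine integral_nonneg_of_ae ?_
    filter_upwards [ae_mem_Icc] with t ht
    exact mul_nonneg (by linarith [ht.2]) (sq_nonneg _)
  have hff : ∑ n ∈ Finset.range R, f n ^ 2
      = ∑ n ∈ Finset.range R, a n ^ 2 / ((n : ℝ) * (n + 2 * lam)) := by
    refine Finset.sum_congr rfl fun n _ => ?_
    rcases Nat.eq_zero_or_pos n with rfl | hn
    · simp [hf]
    · rw [hf, div_pow, Real.sq_sqrt (eigenvalue_pos hlam hn).le]
  rw [integral_norm_sq_finiteExpansion hlam hfR, hff] at hineq
  have hQ := integral_one_sub_mul_norm_sq (memLp_finiteExpansion (𝕜 := 𝕜) hlam a R)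
  rw [integral_norm_sq_finiteExpansion hlam haR,
    integral_mul_norm_sq_finiteExpansion hlam (ha0 0 (Nat.zero_le _)) haR] at hQ
  rw [← hQ] at hle
  set S := ∑ n ∈ Finset.range R, a n ^ 2 / ((n : ℝ) * (n + 2 * lam))
  set Q := ∫ t, (1 - t) * ‖finiteExpansion 𝕜 lam a R t‖ ^ 2 ∂(measure lam)
  have hc : 0 ≤ c := by
    by_contra! hc
    have := mul_nonpos_of_nonpos_of_nonneg hc.le hQ0
    linarith
  refine ⟨hc, ?_⟩
  have h1 : S ≤ c * ((betaInf lam + ε) * S) := hineq.trans (mul_le_mul_of_nonneg_left hle hc)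
  by_contra! hlt
  have := mul_lt_mul_of_pos_right hlt hS
  linarith

theorem HardyRellich.one_le_mul_betaInf (hlam : -1 / 2 < lam) {s : ℝ} {n₀ : ℕ} {c : ℝ}
    (H : HardyRellich 𝕜 lam s n₀ c) : 1 ≤ c * betaInf lam := by
  refine le_of_forall_pos_le_add fun ε hε => ?_
  have hc := (H.one_le hlam one_pos).1
  -- Scaling by `c + 1` instead of `c` keeps the denominator positive when `c = 0`.
  have h := (H.one_le hlam (show 0 < ε / (c + 1) by positivity)).2
  have h2 : c * (ε / (c + 1)) ≤ ε := by
    rw [mul_div_assoc', div_le_iff₀ (by positivity)]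
    nlinarith
  linarith

/-! ### The inequality with the sharp constant. -/

/-- The Jacobi form is bounded below by the weights `β_λ(n)`. -/
theorem tsum_beta_le (hlam : -1 / 2 < lam) {f g : ℝ → 𝕜} (hfg : IsFracPow lam (1 / 2) f g) :
    (Summable fun k => beta lam (k + 1) * ‖orthoCoeff lam f (k + 1)‖ ^ 2) ∧
    ∑' k, beta lam (k + 1) * ‖orthoCoeff lam f (k + 1)‖ ^ 2
      ≤ ∫ t, (1 - t) * ‖g t‖ ^ 2 ∂(measure lam) := by
  have hg := hfg.memLp_right
  have hco : ∀ n : ℕ, orthoCoeff lam g n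
      = √((n : ℝ) * (n + 2 * lam)) • orthoCoeff lam f n := fun n => by
    rw [Real.sqrt_eq_rpow]
    exact (coeff_eq_smul_iff hlam).1 (hfg.coeff_eq n)
  have h0 : orthoCoeff lam g 0 = 0 := by rw [hco 0]; simp
  have hsq : HasSum (fun k => ‖orthoCoeff lam g (k + 1)‖ ^ 2)
      (∫ t, ‖g t‖ ^ 2 ∂(measure lam)) := by
    have := (hasSum_nat_add_iff' 1).2 (hasSum_norm_sq_orthoCoeff hlam hg)
    simpa [h0] using this
  have hJ := hasSum_jacobi hlam hg h0
  set d : ℕ → ℝ := fun k => alpha lam (k + 1) * ‖orthoCoeff lam g (k + 1)‖ with hd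
  have hdsum : Summable fun k => d k ^ 2 := by
    obtain ⟨B, hB⟩ := bddAbove_alpha hlam
    refine (hsq.summable.mul_left B).of_nonneg_of_le (fun k => sq_nonneg _) fun k => ?_
    rw [hd, mul_pow]
    exact mul_le_mul_of_nonneg_right (hB _) (sq_nonneg _)
  have hdsum' : Summable fun k : ℕ => (1 - 1 / (8 * ((k : ℝ) + 1) ^ 2)) * d k ^ 2 := by
    refine hdsum.of_nonneg_of_le (fun k => mul_nonneg ?_ (sq_nonneg _))
      (fun k => mul_le_of_le_one_left (sq_nonneg _) ?_)
    · rw [sub_nonneg, div_le_one (by positivity)]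
      have hk : (0 : ℝ) ≤ k := Nat.cast_nonneg k
      nlinarith
    · linarith [show 0 ≤ 1 / (8 * ((k : ℝ) + 1) ^ 2) by positivity]
  obtain ⟨hh1, hh2⟩ := tsum_mul_succ_le_hardy hdsum
  have hJle : ∫ t, t * ‖g t‖ ^ 2 ∂(measure lam) ≤ ∑' k, d k * d (k + 1) := by
    rw [← hJ.tsum_eq]
    refine hJ.summable.tsum_le_tsum (fun k => ?_) hh1
    rw [← alpha_mul_succ hlam (show 1 ≤ k + 1 by omega)]
    have h1 := RCLike.re_le_norm (star (orthoCoeff lam g (k + 1)) * orthoCoeff lam g (k + 2))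
    rw [norm_mul, norm_star] at h1
    calc _ ≤ alpha lam (k + 1) * alpha lam (k + 1 + 1) *
          (‖orthoCoeff lam g (k + 1)‖ * ‖orthoCoeff lam g (k + 2)‖) :=
          mul_le_mul_of_nonneg_left h1 (mul_nonneg (alpha_pos hlam (by omega)).le
            (alpha_pos hlam (by omega)).le)
      _ = _ := by simp only [hd]; ring
  have hterm : ∀ k : ℕ, beta lam (k + 1) * ‖orthoCoeff lam f (k + 1)‖ ^ 2
      = ‖orthoCoeff lam g (k + 1)‖ ^ 2 - (1 - 1 / (8 * ((k : ℝ) + 1) ^ 2)) * d k ^ 2 := by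
    intro k
    have he := eigenvalue_pos hlam (show 1 ≤ k + 1 by omega)
    simp only [hd]
    rw [hco (k + 1), norm_smul, Real.norm_eq_abs, abs_of_nonneg (Real.sqrt_nonneg _), mul_pow,
      mul_pow, mul_pow, Real.sq_sqrt he.le, beta]
    push_cast
    ring
  simp only [hterm]
  refine ⟨hsq.summable.sub hdsum', ?_⟩
  rw [hsq.summable.tsum_sub hdsum', hsq.tsum_eq, integral_one_sub_mul_norm_sq hg]
  linarith

/-- The Hardy–Rellich inequality with the sharp constant beyond the threshold. -/
theorem IsThreshold.hardyRellich (hlam : -1 / 2 < lam) (hne : lam ≠ 1 / 2) {N : ℕ}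
    (hN : IsThreshold lam N) (s : ℝ) :
    HardyRellich 𝕜 lam s N (8 / (2 * lam - 1) ^ 2) := by
  intro f g hfg _ hvan
  have hβ : 0 < betaInf lam := by
    have : 2 * lam - 1 ≠ 0 := fun h => hne (by linarith)
    rw [betaInf]
    positivity
  have hvan' : ∀ j ≤ N, orthoCoeff lam f j = 0 := fun j hj =>
    (coeff_eq_zero_iff hlam).1 (hvan j hj)
  obtain ⟨h1, h2⟩ := tsum_beta_le hlam hfg
  have hsq : HasSum (fun k => ‖orthoCoeff lam f (k + 1)‖ ^ 2)
      (∫ t, ‖f t‖ ^ 2 ∂(measure lam)) := by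
    have := (hasSum_nat_add_iff' 1).2 (hasSum_norm_sq_orthoCoeff hlam hfg.memLp_left)
    simpa [hvan' 0 (Nat.zero_le _)] using this
  have h3 : betaInf lam * ∫ t, ‖f t‖ ^ 2 ∂(measure lam)
      ≤ ∑' k, beta lam (k + 1) * ‖orthoCoeff lam f (k + 1)‖ ^ 2 := by
    rw [← hsq.tsum_eq, ← tsum_mul_left]
    refine (hsq.summable.mul_left _).tsum_le_tsum (fun k => ?_) h1
    -- Up to `N` the sign of `β - β_λ(∞)` is irrelevant, since the coefficients vanish; beyond it
    -- the threshold applies.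
    rcases le_or_gt (k + 1) N with h | h
    · rw [hvan' _ h]
      simp
    · exact mul_le_mul_of_nonneg_right (hN.le_beta (by omega) h.le) (sq_nonneg _)
  rw [show 8 / (2 * lam - 1) ^ 2 = (betaInf lam)⁻¹ by rw [betaInf, inv_div],
    ← div_eq_inv_mul, le_div_iff₀ hβ, mul_comm]
  exact h3.trans h2

end Gegenbauer

end

theorem mainTheorem2 (𝕜 : Type*) [RCLike 𝕜] (lam : ℝ) (hlam : -1 / 2 < lam)
    (s : ℝ) (hs : 1 / 2 ≤ s) :
    (lam ≠ 1 / 2 → ∀ (n₀ : ℕ) (c : ℝ), Gegenbauer.HardyRellich 𝕜 lam s n₀ c →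
      8 / (2 * lam - 1) ^ 2 ≤ c) ∧
    (lam = 1 / 2 → ∀ (n₀ : ℕ) (c : ℝ), ¬ Gegenbauer.HardyRellich 𝕜 lam s n₀ c) ∧
    (0 ≤ lam → ∃ N : ℕ, Gegenbauer.IsThreshold lam N) ∧
    (lam ≠ 1 / 2 → ∀ N : ℕ, Gegenbauer.IsThreshold lam N →
      Gegenbauer.HardyRellich 𝕜 lam s N (8 / (2 * lam - 1) ^ 2)) := by
  refine ⟨fun hne n₀ c H => ?_, fun heq n₀ c H => ?_, Gegenbauer.exists_isThreshold,
    fun hne N hN => hN.hardyRellich hlam hne s⟩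
  · have h := H.one_le_mul_betaInf hlam
    have hne' : 2 * lam - 1 ≠ 0 := fun h => hne (by linarith)
    rw [Gegenbauer.betaInf] at h
    rw [div_le_iff₀ (by positivity)]
    linarith
  -- Here `β_λ(∞) = 0`, so the bound reads `1 ≤ 0`.
  · have h := H.one_le_mul_betaInf hlam
    rw [Gegenbauer.betaInf, heq] at h
    norm_num at h
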